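/- Let $R>0$ and let $B(R)\subset\mathbb{R}^2$ be the open disk of radius $R$ centred at the origin, with coordinates $(u,v)$. Let $\mathcal{A}=W^{1,2}(B(R))\times W^{1,2}(B(R))\times W^{2,2}(B(R))$, with elements $\mathbf{x}=(f,g,\omega)$. Define the in-plane strains $$\gamma_{11}=2f_u+\omega_u^2-\tfrac{v^2}{3},\qquad \gamma_{12}=f_v+g_u+\omega_u\omega_v+\tfrac{uv}{3},\qquad \gamma_{22}=2g_v+\omega_v^2-\tfrac{u^2}{3},$$ the stretching energy $S[\mathbf{x}]=\int_{B(R)}(\gamma_{11}^2+2\gamma_{12}^2+\gamma_{22}^2)\,du\,dv$, and the bending energy $\mathfrak{B}[\omega]=\int_{B(R)}\|D^2\omega\|^2\,du\,dv$, where $\|D^2\omega\|^2$ is the sum of the squares of the second derivatives. For $t>0$ let $F_t=\frac1{t^2}\left(S+t^2\mathfrak{B}\right)$. Call $\mathbf{x}$ a small-slopes isometry if $\gamma_{11}=\gamma_{12}=\gamma_{22}=0$ a.e. in $B(R)$, and let $F_0[\mathbf{x}]=\mathfrak{B}[\omega]$ if $\mathbf{x}$ is a small-slopes isometry, $F_0[\mathbf{x}]=\infty$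 otherwise. Let $\mathcal{A}_0\subset\mathcal{A}$ be the set of normalized configurations, for which $f(0)=g(0)=\omega(0)=\omega_u(0)=\omega_v(0)=0$; here $h(0)=c$ means that the origin is a Lebesgue point of $h$ with value $c$, i.e. the mean of $|h-c|$ over the disk of radius $r$ about the origin tends to $0$ as $r\to0^+$. **Theorem.** 1. If $\omega\in W^{2,2}(B(R))$ satisfies $\det D^2\omega=-1$ a.e. in $B(R)$, then $\|D^2\omega\|^2\ge 2$ a.e. in $B(R)$ and hence $\mathfrak{B}[\omega]\ge 2\pi R^2$. If $(f,g,\omega)\in\mathcal{A}$ is a small-slopes isometry, then $\det D^2\omega=-1$ a.e. in $B(R)$. 2. There is a configuration in $\mathcal{A}_0$ with $\omega=\frac12(u^2-v^2)$ that minimizes $F_0$ over $\mathcal{A}_0$ and over $\mathcal{A}$, and $$\min_{\mathcal{A}_0}F_0=\min_{\mathcal{A}}F_0=2\pi R^2=\lim_{t\to0^+}\inf_{\mathcal{A}_0}F_t.$$ 3. Let $t_k>0$ with $t_k\to0$, and let $\mathbf{x}_k\in\mathcal{A}_0$ satisfy $F_{t_k}[\mathbf{x}_k]=\min_{\mathcal{A}_0}F_{t_k}$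 for every $k$. Then $\lim_{k\to\infty}F_{t_k}[\mathbf{x}_k]=2\pi R^2$. If a subsequence of $(\mathbf{x}_k)$ converges weakly in $\mathcal{A}$ to $\mathbf{x}^*=(f^*,g^*,\omega^*)$, then $\mathbf{x}^*$ minimizes $F_0$ over $\mathcal{A}$ and $F_0[\mathbf{x}^*]=2\pi R^2$; that is, $\mathbf{x}^*$ is a small-slopes isometry, $\det D^2\omega^*=-1$ a.e. in $B(R)$, and $\mathfrak{B}[\omega^*]\le\mathfrak{B}[\omega]$ for every small-slopes isometry $(f,g,\omega)$. Moreover, up to a rotation of the $(u,v)$-plane about the origin and the addition of an affine function, $\omega^*$ is the two-wave saddle $\frac12(u^2-v^2)$. If $\mathbf{x}^*\in\mathcal{A}_0$, then $\omega^*$ is this saddle up to a rotation alone. -/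

import Mathlib

open MeasureTheory Filter Topology
open scoped ENNReal ContDiff

namespace SmallSlopes

noncomputable section

/-- The Euclidean plane; the coordinates `(u, v)` of `p` are `p 0` and `p 1`. -/
abbrev Plane : Type := EuclideanSpace ℝ (Fin 2)

/-- The open disk `B(R)` centred at the origin. -/
def disk (R : ℝ) : Set Plane := Metric.ball 0 R

/-- The area measure of the disk `B(R)`. -/
def area (R : ℝ) : Measure Plane := volume.restrict (disk R)

instance (R : ℝ) : IsFiniteMeasure (area R) :=
  ⟨by simpa [area, disk] using (measure_ball_lt_top (μ := volume) (x := (0 : Plane)) (r := R))⟩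

/-- The space `L²(B(R))`. -/
abbrev L2 (R : ℝ) : Type := Lp ℝ 2 (area R)

/-- The classical partial derivative in the `i`-th coordinate. -/
def partialDeriv (i : Fin 2) (η : Plane → ℝ) (p : Plane) : ℝ :=
  fderiv ℝ η p (EuclideanSpace.single i 1)

/-- Test functions: smooth functions with compact support in the open disk. -/
structure IsTest (R : ℝ) (η : Plane → ℝ) : Prop where
  smooth : ContDiff ℝ ∞ η
  compact : HasCompactSupport η
  supp : tsupport η ⊆ disk R

/-- `k` is the weak partial derivative of `h` on `B(R)` in the `i`-th coordinate. -/
def IsWeakPartial {R : ℝ} (i : Fin 2) (h k : L2 R) : Prop :=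
  ∀ η : Plane → ℝ, IsTest R η →
    ∫ p, h p * partialDeriv i η p ∂(area R) = - ∫ p, k p * η p ∂(area R)

lemma IsTest.continuous_partialDeriv {R : ℝ} {η : Plane → ℝ} (hη : IsTest R η) (i : Fin 2) :
    Continuous (partialDeriv i η) :=
  (hη.smooth.continuous_fderiv (by simp)).clm_apply continuous_const

lemma IsTest.hasCompactSupport_partialDeriv {R : ℝ} {η : Plane → ℝ} (hη : IsTest R η)
    (i : Fin 2) : HasCompactSupport (partialDeriv i η) :=
  (hη.compact.fderiv (𝕜 := ℝ)).comp_left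
    (g := fun L : Plane →L[ℝ] ℝ => L (EuclideanSpace.single i 1)) rfl

lemma integrable_mul_of_hasCompactSupport {R : ℝ} (h : L2 R) {ψ : Plane → ℝ}
    (hc : Continuous ψ) (hs : HasCompactSupport ψ) :
    Integrable (fun p => h p * ψ p) (area R) := by
  have h1 : Integrable (fun p => h p) (area R) := (Lp.memLp h).integrable (by norm_num)
  obtain ⟨C, hC⟩ := hs.exists_bound_of_continuous hc
  exact h1.mul_bdd hc.aestronglyMeasurable (Eventually.of_forall hC)

lemma isWeakPartial_zero {R : ℝ} (i : Fin 2) : IsWeakPartial i (0 : L2 R) 0 := by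
  intro η _
  have e : ∀ ψ : Plane → ℝ, ∫ p, (0 : L2 R) p * ψ p ∂(area R) = 0 := fun ψ => by
    rw [← integral_zero Plane ℝ (μ := area R)]
    refine integral_congr_ae ?_
    filter_upwards [Lp.coeFn_zero ℝ 2 (area R)] with p hp
    rw [hp, Pi.zero_apply, zero_mul]
  rw [e, e, neg_zero]

lemma IsWeakPartial.add {R : ℝ} {i : Fin 2} {h k h' k' : L2 R}
    (H : IsWeakPartial i h k) (H' : IsWeakPartial i h' k') :
    IsWeakPartial i (h + h') (k + k') := by
  intro η hη
  have e : ∀ (a b : L2 R) {ψ : Plane → ℝ}, Continuous ψ → HasCompactSupport ψ →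
      ∫ p, (a + b) p * ψ p ∂(area R) =
        ∫ p, a p * ψ p ∂(area R) + ∫ p, b p * ψ p ∂(area R) := fun a b ψ hc hs => by
    rw [← integral_add (integrable_mul_of_hasCompactSupport a hc hs)
      (integrable_mul_of_hasCompactSupport b hc hs)]
    refine integral_congr_ae ?_
    filter_upwards [Lp.coeFn_add a b] with p hp
    rw [hp, Pi.add_apply, add_mul]
  rw [e _ _ (hη.continuous_partialDeriv i) (hη.hasCompactSupport_partialDeriv i),
    e _ _ hη.smooth.continuous hη.compact, H η hη, H' η hη, neg_add]

lemma IsWeakPartial.smul {R : ℝ} {i : Fin 2} {h k : L2 R} (c : ℝ)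
    (H : IsWeakPartial i h k) : IsWeakPartial i (c • h) (c • k) := by
  intro η hη
  have e : ∀ (a : L2 R) (ψ : Plane → ℝ),
      ∫ p, (c • a) p * ψ p ∂(area R) = c * ∫ p, a p * ψ p ∂(area R) := fun a ψ => by
    rw [← integral_const_mul]
    refine integral_congr_ae ?_
    filter_upwards [Lp.coeFn_smul c a] with p hp
    rw [hp, Pi.smul_apply, smul_eq_mul, mul_assoc]
  rw [e, e, H η hη, mul_neg]

/-- The Sobolev space `W^{1,2}(B(R))`. An element is a function of `L²(B(R))` together with its
weak first partial derivatives (unique as elements of `L²(B(R))`); the topology is that of the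
usual Sobolev norm. -/
def W12 (R : ℝ) : Submodule ℝ (L2 R × (Fin 2 → L2 R)) where
  carrier := {f | ∀ i, IsWeakPartial i f.1 (f.2 i)}
  zero_mem' := fun i => isWeakPartial_zero i
  add_mem' := fun ha hb i => (ha i).add (hb i)
  smul_mem' := fun c _ ha i => (ha i).smul c

/-- The Sobolev space `W^{2,2}(B(R))`. An element is a function of `L²(B(R))` together with its
weak partial derivatives of orders one and two; the topology is that of the usual Sobolev norm. -/
def W22 (R : ℝ) : Submodule ℝ (L2 R × (Fin 2 → L2 R) × (Fin 2 → Fin 2 → L2 R)) where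
  carrier := {w | (∀ i, IsWeakPartial i w.1 (w.2.1 i)) ∧
    ∀ i j, IsWeakPartial j (w.2.1 i) (w.2.2 i j)}
  zero_mem' := ⟨fun i => isWeakPartial_zero i, fun _ j => isWeakPartial_zero j⟩
  add_mem' := fun ha hb =>
    ⟨fun i => (ha.1 i).add (hb.1 i), fun i j => (ha.2 i j).add (hb.2 i j)⟩
  smul_mem' := fun c _ ha => ⟨fun i => (ha.1 i).smul c, fun i j => (ha.2 i j).smul c⟩

variable {R : ℝ}

/-- The underlying function of an element of `W^{1,2}`. -/
def W12.fn (f : W12 R) : L2 R := f.1.1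

/-- The weak first derivatives of an element of `W^{1,2}`. -/
def W12.d (f : W12 R) (i : Fin 2) : L2 R := f.1.2 i

/-- The underlying function of an element of `W^{2,2}`. -/
def W22.fn (w : W22 R) : L2 R := w.1.1

/-- The weak first derivatives of an element of `W^{2,2}`. -/
def W22.d (w : W22 R) (i : Fin 2) : L2 R := w.1.2.1 i

/-- The weak Hessian `D²ω` of an element of `W^{2,2}`. -/
def W22.hessian (w : W22 R) (p : Plane) : Matrix (Fin 2) (Fin 2) ℝ :=
  Matrix.of fun i j => (w.1.2.2 i j : L2 R) p

/-- `‖D²ω‖²`, the sum of the squares of the second derivatives. -/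
def W22.hessianNormSq (w : W22 R) (p : Plane) : ℝ := ∑ i, ∑ j, (W22.hessian w p i j) ^ 2

/-- The hyperbolic Monge-Ampère equation `det D²ω = -1`, almost everywhere on `B(R)`. -/
def SolvesMongeAmpere (w : W22 R) : Prop := ∀ᵐ p ∂(area R), (W22.hessian w p).det = -1

/-- The bending energy `∫_{B(R)} ‖D²ω‖²`. -/
def bending (w : W22 R) : ℝ≥0∞ := ∫⁻ p, ENNReal.ofReal (W22.hessianNormSq w p) ∂(area R)

variable (R) in
/-- The space `𝒜` of configurations `(f, g, ω)`. -/
abbrev Config : Type := W12 R × W12 R × W22 R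

/-- In-plane displacement along the first axis. -/
def Config.f (x : Config R) : W12 R := x.1

/-- In-plane displacement along the second axis. -/
def Config.g (x : Config R) : W12 R := x.2.1

/-- Out-of-plane displacement. -/
def Config.ω (x : Config R) : W22 R := x.2.2

/-- `γ₁₁ = 2 f_u + ω_u² - v²/3`. -/
def strain11 (x : Config R) (p : Plane) : ℝ :=
  2 * W12.d (Config.f x) 0 p + (W22.d (Config.ω x) 0 p) ^ 2 - (p 1) ^ 2 / 3

/-- `γ₁₂ = f_v + g_u + ω_u ω_v + uv/3`. -/
def strain12 (x : Config R) (p : Plane) : ℝ :=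
  W12.d (Config.f x) 1 p + W12.d (Config.g x) 0 p
    + W22.d (Config.ω x) 0 p * W22.d (Config.ω x) 1 p + p 0 * p 1 / 3

/-- `γ₂₂ = 2 g_v + ω_v² - u²/3`. -/
def strain22 (x : Config R) (p : Plane) : ℝ :=
  2 * W12.d (Config.g x) 1 p + (W22.d (Config.ω x) 1 p) ^ 2 - (p 0) ^ 2 / 3

/-- Small-slopes isometries: all in-plane strains vanish. -/
def IsIsometric (x : Config R) : Prop :=
  ∀ᵐ p ∂(area R), strain11 x p = 0 ∧ strain12 x p = 0 ∧ strain22 x p = 0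

/-- The stretching energy `S`. -/
def stretching (x : Config R) : ℝ≥0∞ :=
  ∫⁻ p, ENNReal.ofReal
    ((strain11 x p) ^ 2 + 2 * (strain12 x p) ^ 2 + (strain22 x p) ^ 2) ∂(area R)

/-- The elastic energy `E_t = S + t² 𝔅`. -/
def elastic (t : ℝ) (x : Config R) : ℝ≥0∞ :=
  stretching x + ENNReal.ofReal (t ^ 2) * bending (Config.ω x)

/-- The rescaled energy `F_t = E_t / t²`. -/
def F (t : ℝ) (x : Config R) : ℝ≥0∞ := elastic t x / ENNReal.ofReal (t ^ 2)

open Classical in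
/-- The limit functional: the bending energy on small-slopes isometries, `∞` elsewhere. -/
def F₀ (x : Config R) : ℝ≥0∞ := if IsIsometric x then bending (Config.ω x) else ∞

/-- The function `h` has the value `c` at the origin: the origin is a Lebesgue point of `h`
with value `c`. For a function with a continuous representative near the origin this is the
value of that representative. -/
def HasValueAtOrigin (h : L2 R) (c : ℝ) : Prop :=
  Tendsto (fun r : ℝ => ⨍ p in Metric.ball (0 : Plane) r, |h p - c|) (𝓝[>] 0) (𝓝 0)

variable (R) in
/-- The normalized configurations `𝒜₀`:
`f(0) = g(0) = ω(0) = 0` and `ω_u(0) = ω_v(0) = 0`. -/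
def A₀ : Set (Config R) :=
  {x | HasValueAtOrigin (W12.fn (Config.f x)) 0 ∧ HasValueAtOrigin (W12.fn (Config.g x)) 0 ∧
    HasValueAtOrigin (W22.fn (Config.ω x)) 0 ∧
    HasValueAtOrigin (W22.d (Config.ω x) 0) 0 ∧ HasValueAtOrigin (W22.d (Config.ω x) 1) 0}

/-- Weak convergence in the normed space `𝒜`. -/
def WeaklyConverges (x : ℕ → Config R) (y : Config R) : Prop :=
  ∀ l : Config R →L[ℝ] ℝ, Tendsto (fun k => l (x k)) atTop (𝓝 (l y))

/-- The two-wave saddle `(u² - v²)/2`. -/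
def saddle (p : Plane) : ℝ := ((p 0) ^ 2 - (p 1) ^ 2) / 2

/-- Rotation of the plane by the angle `α`. -/
def rot (α : ℝ) (p : Plane) : Plane :=
  !₂[Real.cos α * p 0 - Real.sin α * p 1, Real.sin α * p 0 + Real.cos α * p 1]

end

end SmallSlopes

open SmallSlopes

/-! In the combination ∂_vv γ₁₁ − 2 ∂_uv γ₁₂ + ∂_uu γ₂₂ the in-plane displacements cancel, since
they enter the strains only through a symmetrized gradient. What remains, in the sense of
distributions, is −2 (det D²ω + 1): the products of first derivatives of ω give the very weak
Hessian determinant (`very_weak_det`), and the terms v²/3, uv/3, u²/3 give the constant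
(`integral_quadratic_test`). This is `very_weak_strain`; when the strains vanish it forces det D²ω =
−1. The identity ‖D²ω‖² + 2 det D²ω = (ω_uu + ω_vv)² + (ω_uv − ω_vu)² then yields ‖D²ω‖² ≥ 2. The
saddle, with suitable cubic in-plane displacements, is an isometry with equality everywhere.

The same two identities control F_t. Tested against a cutoff 0 ≤ η ≤ 1, the bending energy dominates
−2 ∫ η det D²ω, and the pairing of the strains with D²η is absorbed by the stretching energy after
completing squares. Hence F_t ≥ 2 ∫ η − t² C(η) uniformly over all configurations (`le_F`). The
saddle has F_t = 2πR² for every t, so the infima converge without any compactness argument.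

Comparison with the saddle shows that the minimizers have stretching at most 2πR² t² and bending at
most 2πR². Along a weakly convergent subsequence the gradients of ω converge strongly on smaller
disks (Rellich, `tendsto_eLpNorm_ext_sub`), so the strains pass to the limit against test functions
and the limit is an isometry (`WeaklyConverges.isIsometric`). Weak lower semicontinuity of the
bending energy makes it a minimizer of F₀.

Rigidity comes from equality in the pointwise bound: D²ω is symmetric and trace-free, and a = ω_uu,
b = ω_uv satisfy a² + b² = 1. They also satisfy a_v = b_u and a_u = −b_v, so both are harmonic and
|∇a|² + |∇b|² = ½ Δ(a² + b²) = 0. Mollification makes this rigorous (`isWeakPartial_dd_zero`). Thus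
D²ω is constant and ω is a rotated saddle plus an affine function (`SolvesMongeAmpere.rigidity`);
the normalization at the origin removes the affine part. -/

namespace SmallSlopes

noncomputable section

variable {R : ℝ}

/-! ### Classical partial derivatives and test functions -/

lemma contDiff_partialDeriv {ψ : Plane → ℝ} (h : ContDiff ℝ ∞ ψ) (i : Fin 2) :
    ContDiff ℝ ∞ (partialDeriv i ψ) :=
  (h.fderiv_right (m := ∞) (by simp)).clm_apply contDiff_const

lemma differentiableAt_of_smooth {ψ : Plane → ℝ} (h : ContDiff ℝ ∞ ψ) (p : Plane) :
    DifferentiableAt ℝ ψ p :=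
  (h.differentiable (by simp)) p

lemma partialDeriv_add {i : Fin 2} {ψ χ : Plane → ℝ} {p : Plane} (hψ : DifferentiableAt ℝ ψ p)
    (hχ : DifferentiableAt ℝ χ p) :
    partialDeriv i (fun q => ψ q + χ q) p = partialDeriv i ψ p + partialDeriv i χ p := by
  simp [partialDeriv, fderiv_fun_add hψ hχ]

lemma partialDeriv_sub {i : Fin 2} {ψ χ : Plane → ℝ} {p : Plane} (hψ : DifferentiableAt ℝ ψ p)
    (hχ : DifferentiableAt ℝ χ p) :
    partialDeriv i (fun q => ψ q - χ q) p = partialDeriv i ψ p - partialDeriv i χ p := by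
  simp [partialDeriv, fderiv_fun_sub hψ hχ]

lemma partialDeriv_neg {i : Fin 2} {ψ : Plane → ℝ} {p : Plane} :
    partialDeriv i (fun q => - ψ q) p = - partialDeriv i ψ p := by
  simp [partialDeriv, fderiv_fun_neg]

lemma partialDeriv_mul {i : Fin 2} {ψ χ : Plane → ℝ} {p : Plane} (hψ : DifferentiableAt ℝ ψ p)
    (hχ : DifferentiableAt ℝ χ p) :
    partialDeriv i (fun q => ψ q * χ q) p = ψ p * partialDeriv i χ p + partialDeriv i ψ p * χ p := by
  simp [partialDeriv, fderiv_fun_mul hψ hχ, mul_comm]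

lemma partialDeriv_const {i : Fin 2} {c : ℝ} {p : Plane} :
    partialDeriv i (fun _ => c) p = 0 := by
  simp [partialDeriv]

lemma partialDeriv_coord (i j : Fin 2) (p : Plane) :
    partialDeriv i (fun q : Plane => q j) p = if i = j then 1 else 0 := by
  have : (fun q : Plane => q j) = (EuclideanSpace.proj j : Plane →L[ℝ] ℝ) := rfl
  rw [partialDeriv, this, ContinuousLinearMap.fderiv]
  simp [eq_comm]

lemma contDiff_coord (j : Fin 2) : ContDiff ℝ ∞ (fun q : Plane => q j) :=
  (EuclideanSpace.proj j : Plane →L[ℝ] ℝ).contDiff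

lemma partialDeriv_comm {ψ : Plane → ℝ} (h : ContDiff ℝ ∞ ψ) (i j : Fin 2) (p : Plane) :
    partialDeriv i (partialDeriv j ψ) p = partialDeriv j (partialDeriv i ψ) p := by
  have hd : DifferentiableAt ℝ (fderiv ℝ ψ) p :=
    ((h.fderiv_right (m := ∞) (by simp)).differentiable (by simp)) p
  have key : ∀ i j : Fin 2, SmallSlopes.partialDeriv i (SmallSlopes.partialDeriv j ψ) p =
      fderiv ℝ (fderiv ℝ ψ) p (EuclideanSpace.single i 1) (EuclideanSpace.single j 1) := by
    intro i j
    have : SmallSlopes.partialDeriv j ψ = fun q => fderiv ℝ ψ q (EuclideanSpace.single j 1) := rfl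
    rw [SmallSlopes.partialDeriv, this, fderiv_clm_apply hd (by fun_prop)]
    simp
  rw [key, key]
  exact (h.contDiffAt.isSymmSndFDerivAt
    (by rw [minSmoothness_of_isRCLikeNormedField]; exact WithTop.coe_le_coe.2 (le_top : (2 : ℕ∞) ≤ ⊤))).eq _ _

lemma partialDeriv_eqOn_of_isOpen {i : Fin 2} {ψ χ : Plane → ℝ} {U : Set Plane} (hU : IsOpen U)
    (h : Set.EqOn ψ χ U) : Set.EqOn (partialDeriv i ψ) (partialDeriv i χ) U := by
  intro p hp
  have : ψ =ᶠ[𝓝 p] χ := Filter.eventuallyEq_of_mem (hU.mem_nhds hp) h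
  rw [partialDeriv, partialDeriv, this.fderiv_eq]

lemma tsupport_partialDeriv_subset (i : Fin 2) (ψ : Plane → ℝ) :
    tsupport (partialDeriv i ψ) ⊆ tsupport ψ :=
  (tsupport_comp_subset (g := fun L : Plane →L[ℝ] ℝ => L (EuclideanSpace.single i 1)) rfl _).trans
    (tsupport_fderiv_subset ℝ)

lemma IsTest.partialDeriv {R : ℝ} {η : Plane → ℝ} (hη : IsTest R η) (i : Fin 2) :
    IsTest R (partialDeriv i η) :=
  ⟨contDiff_partialDeriv hη.smooth i, hη.hasCompactSupport_partialDeriv i,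
    (tsupport_partialDeriv_subset i η).trans hη.supp⟩

lemma IsTest.mul_left {R : ℝ} {η ψ : Plane → ℝ} (hη : IsTest R η) (hψ : ContDiff ℝ ∞ ψ) :
    IsTest R (fun p => ψ p * η p) :=
  ⟨hψ.mul hη.smooth, hη.compact.mul_left, (tsupport_mul_subset_right).trans hη.supp⟩

/-- The integral of a partial derivative of a compactly supported function vanishes. -/
lemma integral_partialDeriv_eq_zero {X : Plane → ℝ} (hX : ContDiff ℝ ∞ X)
    (hc : HasCompactSupport X) (i : Fin 2) : ∫ p, partialDeriv i X p = 0 := by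
  have hcont : Continuous (SmallSlopes.partialDeriv i X) := (contDiff_partialDeriv hX i).continuous
  have hcs : HasCompactSupport (SmallSlopes.partialDeriv i X) :=
    (hc.fderiv (𝕜 := ℝ)).comp_left
      (g := fun L : Plane →L[ℝ] ℝ => L (EuclideanSpace.single i 1)) rfl
  -- Integration by parts against the constant function 1, whose derivative vanishes.
  have h := integral_mul_fderiv_eq_neg_fderiv_mul_of_integrable (μ := (volume : Measure Plane))
    (f := fun _ => (1 : ℝ)) (g := X) (v := EuclideanSpace.single i 1) (by simp)
    (by simp only [one_mul]; exact hcont.integrable_of_hasCompactSupport hcs)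
    (by simpa using hX.continuous.integrable_of_hasCompactSupport hc)
    (fun _ _ => differentiableAt_const _) (fun p _ => differentiableAt_of_smooth hX p)
  simp only [one_mul, fderiv_fun_const, Pi.zero_apply, zero_apply, zero_mul, integral_zero,
    neg_zero] at h
  exact h


/-! ### Functions on the disk and their weak derivatives -/

lemma disk_measurableSet : MeasurableSet (disk R) := Metric.isOpen_ball.measurableSet

/-- Integrals over the disk of functions that vanish outside of it are integrals over the plane. -/
lemma integral_area_eq_of_support {F : Plane → ℝ} (hF : ∀ p, p ∉ disk R → F p = 0) :
    ∫ p, F p ∂(area R) = ∫ p, F p :=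
  setIntegral_eq_integral_of_forall_compl_eq_zero hF

lemma IsTest.eq_zero_of_notMem {η : Plane → ℝ} (hη : IsTest R η) {p : Plane} (hp : p ∉ disk R) :
    η p = 0 :=
  image_eq_zero_of_notMem_tsupport fun h => hp (hη.supp h)

/-- A compact support inside the open disk lies in a smaller disk. -/
lemma IsTest.exists_radius (hR : 0 < R) {η : Plane → ℝ} (hη : IsTest R η) :
    ∃ r, 0 < r ∧ r < R ∧ tsupport η ⊆ disk r := by
  obtain ⟨r, hr, h⟩ := exists_pos_lt_subset_ball hR (isClosed_tsupport η) hη.supp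
  exact ⟨r, hr.1, hr.2, h⟩

lemma memLp_of_continuous {ψ : Plane → ℝ} (hψ : Continuous ψ) : MemLp ψ 2 (area R) := by
  obtain ⟨C, hC⟩ := (isCompact_closedBall (0 : Plane) R).exists_bound_of_continuousOn
    hψ.continuousOn
  refine MemLp.of_bound hψ.aestronglyMeasurable C ?_
  filter_upwards [ae_restrict_mem disk_measurableSet] with p hp
  exact hC p (Metric.ball_subset_closedBall hp)

/-- The element of `L²(B(R))` given by a continuous function. -/
def ofCont (R : ℝ) (ψ : Plane → ℝ) (hψ : Continuous ψ) : L2 R := (memLp_of_continuous hψ).toLp ψ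

lemma ofCont_ae (ψ : Plane → ℝ) (hψ : Continuous ψ) : ofCont R ψ hψ =ᵐ[area R] ψ :=
  MemLp.coeFn_toLp _

lemma isWeakPartial_ofCont {i : Fin 2} {ψ χ : Plane → ℝ} (hψ : ContDiff ℝ ∞ ψ) (hχ : Continuous χ)
    (h : ∀ p, partialDeriv i ψ p = χ p) :
    IsWeakPartial i (ofCont R ψ hψ.continuous) (ofCont R χ hχ) := by
  intro η hη
  have e1 : ∫ p, ofCont R ψ hψ.continuous p * SmallSlopes.partialDeriv i η p ∂(area R) =
      ∫ p, ψ p * SmallSlopes.partialDeriv i η p := by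
    rw [← integral_area_eq_of_support (R := R)
      (fun p hp => by simp [(hη.partialDeriv i).eq_zero_of_notMem hp])]
    refine integral_congr_ae ?_
    filter_upwards [ofCont_ae (R := R) ψ hψ.continuous] with p hp
    rw [hp]
  have e2 : ∫ p, ofCont R χ hχ p * η p ∂(area R) = ∫ p, χ p * η p := by
    rw [← integral_area_eq_of_support (R := R)
      (fun p hp => by simp [hη.eq_zero_of_notMem hp])]
    refine integral_congr_ae ?_
    filter_upwards [ofCont_ae (R := R) χ hχ] with p hp
    rw [hp]
  rw [e1, e2]
  have h0 := integral_partialDeriv_eq_zero (hη.mul_left hψ).smooth (hη.mul_left hψ).compact i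
  have i1 : Integrable (fun p => ψ p * SmallSlopes.partialDeriv i η p) :=
    (hψ.continuous.mul (hη.continuous_partialDeriv i)).integrable_of_hasCompactSupport
      (hη.hasCompactSupport_partialDeriv i).mul_left
  have i2 : Integrable (fun p => χ p * η p) :=
    (hχ.mul hη.smooth.continuous).integrable_of_hasCompactSupport hη.compact.mul_left
  have : ∀ p, SmallSlopes.partialDeriv i (fun q => ψ q * η q) p =
      ψ p * SmallSlopes.partialDeriv i η p + χ p * η p := fun p => by
    rw [partialDeriv_mul (differentiableAt_of_smooth hψ p) (differentiableAt_of_smooth hη.smooth p), h]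
  simp_rw [this] at h0
  rw [integral_add i1 i2] at h0
  linarith

/-- A locally integrable function on the disk that is orthogonal to all test functions vanishes. -/
lemma ae_eq_zero_of_forall_test {F : Plane → ℝ} (hF : Integrable F (area R))
    (h : ∀ η, IsTest R η → ∫ p, F p * η p ∂(area R) = 0) : ∀ᵐ p ∂(area R), F p = 0 := by
  have h1 := IsOpen.ae_eq_zero_of_integral_contDiff_smul_eq_zero (f := F) (μ := area R)
    (U := disk R) Metric.isOpen_ball (hF.locallyIntegrable.locallyIntegrableOn _)
    (fun g hg hc hs => by
      rw [← h g ⟨hg, hc, hs⟩]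
      simp only [smul_eq_mul, mul_comm])
  filter_upwards [h1, ae_restrict_mem disk_measurableSet] with p hp hm
  exact hp hm

lemma isWeakPartial_sub {i : Fin 2} {h k h' k' : L2 R}
    (H : IsWeakPartial i h k) (H' : IsWeakPartial i h' k') :
    IsWeakPartial i (h - h') (k - k') := by
  have := H.add (H'.smul (-1))
  simpa [sub_eq_add_neg] using this

/-! ### Mollification and convergence in `L²` -/

lemma eLpNorm_two_sq {α : Type*} [MeasurableSpace α] (μ : Measure α) (f : α → ℝ) :
    eLpNorm f 2 μ ^ 2 = ∫⁻ x, ‖f x‖ₑ ^ 2 ∂μ := by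
  have := eLpNorm_nnreal_pow_eq_lintegral (f := f) (μ := μ) (p := 2) (by norm_num)
  simpa using this

lemma enorm_sq (a : ℝ) : ‖a‖ₑ ^ 2 = ENNReal.ofReal (a ^ 2) := by
  rw [← Real.enorm_of_nonneg (sq_nonneg a), enorm_pow]

/-- Jensen's inequality under the integral sign, for the `L²` seminorm. -/
lemma eLpNorm_two_le_of_le_lintegral {α β : Type*} [MeasurableSpace α] [MeasurableSpace β]
    {μ : Measure α} [SFinite μ] {ν : Measure β} [IsProbabilityMeasure ν] {u : α → ℝ}
    {H : α → β → ℝ} (hH : Measurable (Function.uncurry H))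
    (hu : ∀ x, ‖u x‖ₑ ≤ ∫⁻ y, ‖H x y‖ₑ ∂ν) {B : ℝ≥0∞}
    (hB : ∀ᵐ y ∂ν, eLpNorm (fun x => H x y) 2 μ ≤ B) : eLpNorm u 2 μ ≤ B := by
  have h1 : ∀ x, ‖u x‖ₑ ^ 2 ≤ ∫⁻ y, ‖H x y‖ₑ ^ 2 ∂ν := fun x => by
    rw [← eLpNorm_two_sq]
    refine pow_le_pow_left' ((hu x).trans ?_) 2
    rw [← eLpNorm_one_eq_lintegral_enorm]
    exact eLpNorm_le_eLpNorm_of_exponent_le (by norm_num)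
      (hH.comp measurable_prodMk_left).aestronglyMeasurable
  have h2 : eLpNorm u 2 μ ^ 2 ≤ B ^ 2 := by
    rw [eLpNorm_two_sq]
    calc ∫⁻ x, ‖u x‖ₑ ^ 2 ∂μ ≤ ∫⁻ x, ∫⁻ y, ‖H x y‖ₑ ^ 2 ∂ν ∂μ := lintegral_mono h1
      _ = ∫⁻ y, ∫⁻ x, ‖H x y‖ₑ ^ 2 ∂μ ∂ν :=
        lintegral_lintegral_swap (hH.enorm.pow_const 2).aemeasurable
      _ ≤ ∫⁻ _, B ^ 2 ∂ν := by
        refine lintegral_mono_ae ?_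
        filter_upwards [hB] with y hy
        rw [← eLpNorm_two_sq]
        exact pow_le_pow_left' hy 2
      _ = B ^ 2 := by simp
  exact (ENNReal.pow_le_pow_left_iff (by norm_num)).1 h2

/-- A sequence of bump functions at the origin with shrinking supports. -/
def bump (n : ℕ) : ContDiffBump (0 : Plane) :=
  ⟨1 / (2 * (n + 1)), 1 / (n + 1), by positivity, by
    rw [div_lt_div_iff₀ (by positivity) (by positivity)]; nlinarith [(n.cast_nonneg : (0:ℝ) ≤ n)]⟩

/-- The mollification kernels. -/
def ker (n : ℕ) : Plane → ℝ := (bump n).normed volume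

lemma ker_smooth (n : ℕ) : ContDiff ℝ ∞ (ker n) := (bump n).contDiff_normed

lemma ker_compact (n : ℕ) : HasCompactSupport (ker n) := (bump n).hasCompactSupport_normed

lemma ker_tsupport (n : ℕ) : tsupport (ker n) = Metric.closedBall 0 (1 / ((n : ℝ) + 1)) :=
  (bump n).tsupport_normed_eq

lemma ker_nonneg (n : ℕ) (p : Plane) : 0 ≤ ker n p := (bump n).nonneg_normed p

lemma ker_integral (n : ℕ) : ∫ p, ker n p = 1 := (bump n).integral_normed

/-- The mollification of a function. -/
def moll (n : ℕ) (F : Plane → ℝ) : Plane → ℝ :=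
  convolution F (ker n) (ContinuousLinearMap.mul ℝ ℝ) volume

lemma moll_apply (n : ℕ) (F : Plane → ℝ) (x : Plane) :
    moll n F x = ∫ t, F t * ker n (x - t) := rfl

lemma moll_apply' (n : ℕ) (F : Plane → ℝ) (x : Plane) :
    moll n F x = ∫ t, ker n t * F (x - t) := by
  rw [moll_apply, ← integral_sub_left_eq_self _ volume x]
  simp [mul_comm]

lemma contDiff_moll (n : ℕ) {F : Plane → ℝ} (hF : LocallyIntegrable F) :
    ContDiff ℝ ∞ (moll n F) :=
  (ker_compact n).contDiff_convolution_right _ hF (ker_smooth n)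

lemma partialDeriv_moll_apply (n : ℕ) {F : Plane → ℝ} (hF : LocallyIntegrable F) (i : Fin 2)
    (x : Plane) : partialDeriv i (moll n F) x = ∫ t, F t * partialDeriv i (ker n) (x - t) := by
  have h := (ker_compact n).hasFDerivAt_convolution_right (ContinuousLinearMap.mul ℝ ℝ) hF
    ((ker_smooth n).of_le (by simp)) x
  rw [partialDeriv, moll, h.fderiv, convolution_precompR_apply _ hF ((ker_compact n).fderiv (𝕜 := ℝ))
    ((ker_smooth n).continuous_fderiv (by simp))]
  rfl

/-- The probability measure with density the mollification kernel. -/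
def kerMeasure (n : ℕ) : Measure Plane := volume.withDensity fun p => ENNReal.ofReal (ker n p)

instance (n : ℕ) : IsProbabilityMeasure (kerMeasure n) := by
  refine ⟨?_⟩
  rw [kerMeasure, withDensity_apply _ MeasurableSet.univ, Measure.restrict_univ,
    ← ofReal_integral_eq_lintegral_ofReal
      ((ker_smooth n).continuous.integrable_of_hasCompactSupport (ker_compact n))
      (Eventually.of_forall (ker_nonneg n)), ker_integral, ENNReal.ofReal_one]

lemma integral_kerMeasure (n : ℕ) (G : Plane → ℝ) :
    ∫ p, G p ∂(kerMeasure n) = ∫ p, ker n p * G p := by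
  rw [kerMeasure, integral_withDensity_eq_integral_toReal_smul
    (ker_smooth n).continuous.measurable.ennreal_ofReal (by simp)]
  simp [ENNReal.toReal_ofReal (ker_nonneg n _)]

lemma ae_kerMeasure (n : ℕ) : ∀ᵐ y ∂(kerMeasure n), ‖y‖ ≤ 1 / ((n : ℝ) + 1) := by
  rw [kerMeasure, ae_withDensity_iff (ker_smooth n).continuous.measurable.ennreal_ofReal]
  refine Eventually.of_forall fun y hy => ?_
  have : y ∈ tsupport (ker n) := by
    by_contra h
    exact hy (by rw [image_eq_zero_of_notMem_tsupport h, ENNReal.ofReal_zero])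
  rw [ker_tsupport] at this
  simpa using this

lemma integrable_ker_mul (n : ℕ) {F : Plane → ℝ} (hF : LocallyIntegrable F) (x : Plane) :
    Integrable fun t => ker n t * F (x - t) := by
  have := ((ker_compact n).convolutionExists_left (ContinuousLinearMap.mul ℝ ℝ)
    (ker_smooth n).continuous hF x)
  exact this

lemma moll_sub_le (n : ℕ) {F : Plane → ℝ} (hF : LocallyIntegrable F) (x : Plane) :
    ‖moll n F x - F x‖ₑ ≤ ∫⁻ y, ‖F (x - y) - F x‖ₑ ∂(kerMeasure n) := by
  have : moll n F x - F x = ∫ y, (F (x - y) - F x) ∂(kerMeasure n) := by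
    rw [integral_kerMeasure, moll_apply']
    have e : F x = ∫ t, ker n t * F x := by rw [integral_mul_const, ker_integral, one_mul]
    nth_rewrite 1 [e]
    rw [← integral_sub (integrable_ker_mul n hF x)
      (((ker_smooth n).continuous.integrable_of_hasCompactSupport (ker_compact n)).mul_const _)]
    simp [mul_sub]
  rw [this]
  exact enorm_integral_le_lintegral_enorm _

/-- The mollification error is controlled by the translation error. -/
lemma eLpNorm_moll_sub_le (n : ℕ) {F : Plane → ℝ} (hm : Measurable F) (hF : LocallyIntegrable F)
    {μ : Measure Plane} [SFinite μ] {B : ℝ≥0∞}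
    (hB : ∀ y : Plane, ‖y‖ ≤ 1 / ((n : ℝ) + 1) → eLpNorm (fun x => F (x - y) - F x) 2 μ ≤ B) :
    eLpNorm (moll n F - F) 2 μ ≤ B := by
  refine eLpNorm_two_le_of_le_lintegral (ν := kerMeasure n) (H := fun x y => F (x - y) - F x) ?_
    (moll_sub_le n hF) ?_
  · exact (hm.comp (measurable_fst.sub measurable_snd)).sub (hm.comp measurable_fst)
  · filter_upwards [ae_kerMeasure n] with y hy using hB y hy

/-- Translations act continuously on `L²` of the plane, so the orbit map of F is continuous at the
origin. -/
lemma tendsto_eLpNorm_translate {F : Plane → ℝ} (hF : MemLp F 2) :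
    Tendsto (fun y : Plane => eLpNorm (fun x => F (x - y) - F x) 2 volume) (𝓝 0) (𝓝 0) := by
  have : Fact ((2 : ℝ≥0∞) ≠ ⊤) := ⟨by norm_num⟩
  have hc : Continuous fun y : Plane => (DomAddAct.mk (-y)) +ᵥ hF.toLp F :=
    (DomAddAct.continuous_mk.comp continuous_neg).vadd continuous_const
  have h := hc.tendsto 0
  simp only [neg_zero, DomAddAct.mk_zero, zero_vadd] at h
  have hmp : ∀ y : Plane, MemLp (fun x => F (-y +ᵥ x)) 2 volume := fun y =>
    hF.comp_measurePreserving (measurePreserving_vadd (-y) volume)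
  have h' : Tendsto (fun y : Plane => (hmp y).toLp (fun x => F (-y +ᵥ x))) (𝓝 0)
      (𝓝 (hF.toLp F)) := h
  rw [Lp.tendsto_Lp_iff_tendsto_eLpNorm''] at h'
  refine h'.congr fun y => ?_
  congr 1
  ext x
  simp [sub_eq_neg_add]

lemma locallyIntegrable_of_memLp {F : Plane → ℝ} (hF : MemLp F 2) : LocallyIntegrable F :=
  hF.locallyIntegrable (by norm_num)

lemma tendsto_inv_add_one : Tendsto (fun n : ℕ => 1 / ((n : ℝ) + 1)) atTop (𝓝 0) :=
  tendsto_one_div_add_atTop_nhds_zero_nat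

/-- Mollifications converge in `L²`. -/
lemma tendsto_moll {F : Plane → ℝ} (hm : Measurable F) (hF : MemLp F 2) :
    Tendsto (fun n => eLpNorm (moll n F - F) 2 volume) atTop (𝓝 0) := by
  rw [ENNReal.tendsto_nhds_zero]
  intro δ hδ
  have h := (ENNReal.tendsto_nhds_zero.1 (tendsto_eLpNorm_translate hF)) δ hδ
  obtain ⟨r, hr, hb⟩ := Metric.eventually_nhds_iff.1 h
  filter_upwards [tendsto_inv_add_one.eventually (gt_mem_nhds hr)] with n hn
  refine eLpNorm_moll_sub_le n hm (locallyIntegrable_of_memLp hF) fun y hy => hb ?_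
  rw [dist_zero_right]
  exact hy.trans_lt hn

/-- The error `moll n F - F` is an average of differences of translates, each of norm at most 2‖F‖;
adding F back gives membership. -/
lemma memLp_moll (n : ℕ) {F : Plane → ℝ} (hm : Measurable F) (hF : MemLp F 2) :
    MemLp (moll n F) 2 := by
  have hl := locallyIntegrable_of_memLp hF
  have h1 : MemLp (moll n F - F) 2 := by
    refine ⟨((contDiff_moll n hl).continuous.aestronglyMeasurable.sub hF.1), ?_⟩
    refine lt_of_le_of_lt (eLpNorm_moll_sub_le n hm hl (B := 2 * eLpNorm F 2 volume) fun y _ => ?_)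
      (ENNReal.mul_lt_top (by simp) hF.2)
    have hmp : MeasurePreserving (fun x : Plane => x - y) volume volume :=
      measurePreserving_sub_right volume y
    have e : eLpNorm (fun x => F (x - y)) 2 volume = eLpNorm F 2 volume :=
      eLpNorm_comp_measurePreserving hF.1 hmp
    refine (eLpNorm_sub_le (hF.comp_measurePreserving hmp).1 hF.1 (by norm_num)).trans ?_
    rw [two_mul]
    exact add_le_add e.le le_rfl
  simpa using h1.add hF

/-- Products of `L²`-convergent families converge weakly in `L¹`. -/
lemma tendsto_integral_mul_mul {α ι : Type*} [MeasurableSpace α] {μ : Measure α} {l : Filter ι}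
    {F G : ι → α → ℝ} {F₀ G₀ ψ : α → ℝ} (hF : ∀ n, MemLp (F n) 2 μ) (hG : ∀ n, MemLp (G n) 2 μ)
    (hF₀ : MemLp F₀ 2 μ) (hG₀ : MemLp G₀ 2 μ)
    (hFt : Tendsto (fun n => eLpNorm (F n - F₀) 2 μ) l (𝓝 0))
    (hGt : Tendsto (fun n => eLpNorm (G n - G₀) 2 μ) l (𝓝 0))
    (hψ : AEStronglyMeasurable ψ μ) {C : ℝ} (hC : ∀ p, ‖ψ p‖ ≤ C) :
    Tendsto (fun n => ∫ p, F n p * G n p * ψ p ∂μ) l (𝓝 (∫ p, F₀ p * G₀ p * ψ p ∂μ)) := by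
  have hψG : ∀ {K : α → ℝ}, MemLp K 2 μ → MemLp (fun p => ψ p * K p) 2 μ := fun hK =>
    hK.of_le_mul (hψ.mul hK.1) (c := C) (Eventually.of_forall fun p => by
      rw [norm_mul]; exact mul_le_mul_of_nonneg_right (hC p) (norm_nonneg _))
  have hGψt : Tendsto (fun n => eLpNorm ((fun p => ψ p * G n p) - fun p => ψ p * G₀ p) 2 μ) l
      (𝓝 0) := by
    have : Tendsto (fun n => ENNReal.ofReal C * eLpNorm (G n - G₀) 2 μ) l (𝓝 0) := by
      simpa using ENNReal.Tendsto.const_mul hGt (Or.inr (ENNReal.ofReal_ne_top (r := C)))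
    refine tendsto_of_tendsto_of_tendsto_of_le_of_le tendsto_const_nhds this
      (fun _ => zero_le) fun n => ?_
    refine eLpNorm_le_mul_eLpNorm_of_ae_le_mul (Eventually.of_forall fun p => ?_) 2
    simp only [Pi.sub_apply, ← mul_sub, norm_mul]
    exact mul_le_mul_of_nonneg_right (hC p) (norm_nonneg _)
  have h1 := (Lp.tendsto_Lp_iff_tendsto_eLpNorm'' F hF F₀ hF₀).2 hFt
  have h2 := (Lp.tendsto_Lp_iff_tendsto_eLpNorm'' (fun n p => ψ p * G n p) (fun n => hψG (hG n))
    _ (hψG hG₀)).2 hGψt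
  have h3 := h1.inner (𝕜 := ℝ) h2
  have e : ∀ {K L : α → ℝ} (hK : MemLp K 2 μ) (hL : MemLp L 2 μ),
      inner ℝ (hK.toLp K) ((hψG hL).toLp (fun p => ψ p * L p)) = ∫ p, K p * L p * ψ p ∂μ := by
    intro K L hK hL
    rw [L2.inner_def]
    refine integral_congr_ae ?_
    filter_upwards [hK.coeFn_toLp, (hψG hL).coeFn_toLp] with p h1 h2
    rw [h1, h2]
    simp; ring
  rw [e hF₀ hG₀] at h3
  exact h3.congr fun n => e (hF n) (hG n)

/-! ### Extension by zero and mollified weak derivatives -/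

/-- Extension by zero of an element of `L²(B(R))`. -/
def ext (h : L2 R) : Plane → ℝ := (disk R).indicator h

lemma ext_measurable (h : L2 R) : Measurable (ext h) :=
  (Lp.stronglyMeasurable h).measurable.indicator disk_measurableSet

lemma ext_memLp (h : L2 R) : MemLp (ext h) 2 :=
  (memLp_indicator_iff_restrict disk_measurableSet).2 (Lp.memLp h)

lemma ext_locallyIntegrable (h : L2 R) : LocallyIntegrable (ext h) :=
  locallyIntegrable_of_memLp (ext_memLp h)

lemma ext_apply (h : L2 R) {p : Plane} (hp : p ∈ disk R) : ext h p = h p :=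
  Set.indicator_of_mem hp _

lemma ext_ae (h : L2 R) : ext h =ᵐ[area R] h := by
  filter_upwards [ae_restrict_mem disk_measurableSet] with p hp using ext_apply h hp

lemma integral_ext_mul (h : L2 R) (ψ : Plane → ℝ) :
    ∫ p, ext h p * ψ p = ∫ p, h p * ψ p ∂(area R) := by
  rw [← integral_area_eq_of_support (R := R) (fun p hp => by simp [ext, hp])]
  refine integral_congr_ae ?_
  filter_upwards [ext_ae h] with p hp
  rw [hp]

lemma eLpNorm_ext (h : L2 R) : eLpNorm (ext h) 2 volume = ‖h‖ₑ := by
  rw [ext, eLpNorm_indicator_eq_eLpNorm_restrict disk_measurableSet, Lp.enorm_def]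
  rfl

/-- The kernel is supported in the ball of radius 1/(n+1), so its reflected translate at x stays
inside the disk when x is farther than that from the boundary. It can then be inserted in the
definition of a weak derivative. -/
lemma isTest_ker_sub (n : ℕ) {x : Plane} (hx : x ∈ disk (R - 1 / ((n : ℝ) + 1))) :
    IsTest R (fun t => ker n (x - t)) := by
  have hs : tsupport (fun t => ker n (x - t)) ⊆ Metric.closedBall x (1 / ((n : ℝ) + 1)) := by
    refine closure_minimal (fun t ht => ?_) Metric.isClosed_closedBall
    have : x - t ∈ tsupport (ker n) := subset_tsupport _ ht
    rw [ker_tsupport, mem_closedBall_zero_iff] at this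
    rwa [Metric.mem_closedBall, dist_comm, dist_eq_norm]
  refine ⟨(ker_smooth n).comp (contDiff_const.sub contDiff_id),
    HasCompactSupport.of_support_subset_isCompact (isCompact_closedBall _ _)
      (subset_closure.trans hs), hs.trans ?_⟩
  refine Metric.closedBall_subset_ball' ?_
  rw [disk, Metric.mem_ball] at hx
  linarith

/-- Mollification commutes with weak partial derivatives, away from the boundary. -/
lemma partialDeriv_moll {n : ℕ} {i : Fin 2} {h k : L2 R} (H : IsWeakPartial i h k) :
    Set.EqOn (partialDeriv i (moll n (ext h))) (moll n (ext k))
      (disk (R - 1 / ((n : ℝ) + 1))) := by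
  intro x hx
  have hd : ∀ t, partialDeriv i (fun t => ker n (x - t)) t = - partialDeriv i (ker n) (x - t) := by
    intro t
    have h1 : HasFDerivAt (fun t : Plane => x - t) (-ContinuousLinearMap.id ℝ Plane) t :=
      (hasFDerivAt_id t).const_sub x
    have h2 := (differentiableAt_of_smooth (ker_smooth n) (x - t)).hasFDerivAt.comp t h1
    have h3 : fderiv ℝ (fun t => ker n (x - t)) t = _ := h2.fderiv
    simp [partialDeriv, h3]
  have := H _ (isTest_ker_sub n hx)
  simp only [hd, mul_neg, integral_neg, neg_inj] at this
  rw [partialDeriv_moll_apply n (ext_locallyIntegrable h), moll_apply, integral_ext_mul,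
    integral_ext_mul, this]

lemma eventually_inv_lt {r : ℝ} (hr : 0 < r) : ∀ᶠ n : ℕ in atTop, 1 / ((n : ℝ) + 1) < r :=
  tendsto_inv_add_one.eventually (gt_mem_nhds hr)

lemma disk_mono {r s : ℝ} (h : r ≤ s) : disk r ⊆ disk s := Metric.ball_subset_ball h

lemma fderiv_eq_zero_of_partialDeriv {ψ : Plane → ℝ} {p : Plane}
    (h : ∀ i, partialDeriv i ψ p = 0) : fderiv ℝ ψ p = 0 := by
  have : (fderiv ℝ ψ p : Plane →ₗ[ℝ] ℝ) = 0 := by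
    refine (EuclideanSpace.basisFun (Fin 2) ℝ).toBasis.ext fun i => ?_
    simpa [partialDeriv] using h i
  ext v
  exact LinearMap.congr_fun this v

lemma tendsto_moll_ae {F : Plane → ℝ} (hF : LocallyIntegrable F) :
    ∀ᵐ x, Tendsto (fun n => moll n F x) atTop (𝓝 (F x)) := by
  -- The outer radius of each bump is exactly twice the inner one; a bounded ratio is what Lebesgue
  -- differentiation needs here.
  have := ContDiffBump.ae_convolution_tendsto_right_of_locallyIntegrable (μ := volume) (φ := bump)
    (l := atTop) (K := 2) tendsto_inv_add_one (Eventually.of_forall fun n => by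
      simp only [bump]; field_simp; rfl) hF
  filter_upwards [this] with x hx
  refine hx.congr fun n => ?_
  rw [moll_apply']
  rfl

/-- A function with vanishing weak gradient is constant. -/
lemma ae_const_of_isWeakPartial_zero (hR : 0 < R) {h : L2 R} (H : ∀ i, IsWeakPartial i h 0) :
    ∃ c : ℝ, ∀ᵐ p ∂(area R), h p = c := by
  have hmoll0 : ∀ n x, moll n (ext (0 : L2 R)) x = 0 := fun n x => by
    rw [moll_apply, integral_ext_mul]
    rw [← integral_zero Plane ℝ (μ := area R)]
    refine integral_congr_ae ?_
    filter_upwards [Lp.coeFn_zero ℝ 2 (area R)] with p hp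
    rw [hp, Pi.zero_apply, zero_mul]
  have hconst : ∀ n : ℕ, ∀ x ∈ disk (R - 1 / ((n : ℝ) + 1)), ∀ y ∈ disk (R - 1 / ((n : ℝ) + 1)),
      moll n (ext h) x = moll n (ext h) y := by
    intro n x hx y hy
    have hsm := contDiff_moll n (ext_locallyIntegrable h)
    refine Metric.isOpen_ball.is_const_of_fderiv_eq_zero (𝕜 := ℝ)
      (convex_ball (0 : Plane) _).isPreconnected
      (fun p _ => (differentiableAt_of_smooth hsm p).differentiableWithinAt) ?_ hx hy
    intro p hp
    exact fderiv_eq_zero_of_partialDeriv fun i => by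
      rw [partialDeriv_moll (H i) hp, hmoll0]
  have hae : ∀ᵐ p ∂(area R), p ∈ disk R ∧ Tendsto (fun n => moll n (ext h) p) atTop (𝓝 (h p)) := by
    filter_upwards [ae_restrict_mem disk_measurableSet,
      ae_restrict_of_ae (tendsto_moll_ae (ext_locallyIntegrable h))] with p hp ht
    rw [ext_apply h hp] at ht
    exact ⟨hp, ht⟩
  have hne : NeZero (area R) := ⟨by
    rw [area, Ne, Measure.restrict_eq_zero]
    exact (Metric.measure_ball_pos volume (0 : Plane) hR).ne'⟩
  obtain ⟨x, hx, hxt⟩ := hae.exists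
  -- The mollifications are constant on disks exhausting `B(R)`. Any point x where they converge to
  -- `h x` supplies the constant, since for large n the disk contains x and any other given point.
  refine ⟨h x, ?_⟩
  filter_upwards [hae] with p ⟨hp, hpt⟩
  refine tendsto_nhds_unique hpt (hxt.congr' ?_)
  rw [disk, mem_ball_zero_iff] at hx hp
  filter_upwards [eventually_inv_lt (sub_pos.2 hx), eventually_inv_lt (sub_pos.2 hp)] with n h1 h2
  refine hconst n x ?_ p ?_ <;> rw [disk, mem_ball_zero_iff] <;> linarith

/-! ### Translation estimates and the rate of mollification -/

lemma fderiv_apply_eq (ψ : Plane → ℝ) (p v : Plane) :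
    fderiv ℝ ψ p v = v 0 * partialDeriv 0 ψ p + v 1 * partialDeriv 1 ψ p := by
  have hv : v = v 0 • EuclideanSpace.single 0 (1 : ℝ) + v 1 • EuclideanSpace.single 1 (1 : ℝ) := by
    ext i; fin_cases i <;> simp
  conv_lhs => rw [hv]
  simp [partialDeriv]

/-- Translation estimate for smooth functions. -/
lemma eLpNorm_translate_sub_le_of_smooth {g : Plane → ℝ} (hg : ContDiff ℝ ∞ g) {r : ℝ} (y : Plane) :
    eLpNorm (fun x => g (x - y) - g x) 2 (area r) ≤
      ‖y‖ₑ * (eLpNorm (partialDeriv 0 g) 2 (area (r + ‖y‖)) +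
        eLpNorm (partialDeriv 1 g) 2 (area (r + ‖y‖))) := by
  let ν : Measure ℝ := volume.restrict (Set.Icc 0 1)
  have : IsProbabilityMeasure ν := ⟨by simp [ν]⟩
  have hgc : Continuous (fderiv ℝ g) := hg.continuous_fderiv (by simp)
  let D : Plane → ℝ := fun p => fderiv ℝ g p (-y)
  have hD : Continuous D := hgc.clm_apply continuous_const
  -- The difference g(x − y) − g(x) is the average over t in [0, 1] of the derivative along the
  -- segment x − t y, so Jensen's inequality applies.
  refine eLpNorm_two_le_of_le_lintegral (ν := ν) (H := fun x t => D (x - t • y))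
    (by simp only [Function.uncurry_def]; fun_prop) ?_ ?_
  · intro x
    have hder : ∀ t : ℝ, HasDerivAt (fun t : ℝ => g (x - t • y)) (D (x - t • y)) t := by
      intro t
      have h1 : HasDerivAt (fun t : ℝ => x - t • y) (-y) t := by
        simpa using ((hasDerivAt_id t).smul_const y).const_sub x
      exact (differentiableAt_of_smooth hg _).hasFDerivAt.comp_hasDerivAt t h1
    have hcont : Continuous fun t : ℝ => D (x - t • y) := by fun_prop
    have h2 := intervalIntegral.integral_eq_sub_of_hasDerivAt (a := 0) (b := 1)
      (fun t _ => hder t) (hcont.intervalIntegrable 0 1)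
    simp only [one_smul, zero_smul, sub_zero] at h2
    rw [← h2, intervalIntegral.integral_of_le zero_le_one, ← integral_Icc_eq_integral_Ioc]
    exact enorm_integral_le_lintegral_enorm _
  · filter_upwards [ae_restrict_mem measurableSet_Icc] with t ht
    -- Since |t y| ≤ |y|, the shifted disk of radius r lies in the disk of radius r + |y|.
    have h1 : eLpNorm (fun x => D (x - t • y)) 2 (area r) ≤ eLpNorm D 2 (area (r + ‖y‖)) := by
      rw [area, area, ← eLpNorm_indicator_eq_eLpNorm_restrict disk_measurableSet,
        ← eLpNorm_indicator_eq_eLpNorm_restrict disk_measurableSet]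
      rw [← eLpNorm_comp_measurePreserving
        ((hD.measurable.indicator disk_measurableSet).aestronglyMeasurable)
        (measurePreserving_sub_right volume (t • y))]
      refine eLpNorm_mono fun x => ?_
      by_cases hx : x ∈ disk r
      · have : x - t • y ∈ disk (r + ‖y‖) := by
          rw [disk, mem_ball_zero_iff] at hx ⊢
          have : ‖t • y‖ ≤ ‖y‖ := by
            rw [norm_smul, Real.norm_of_nonneg ht.1]
            exact mul_le_of_le_one_left (norm_nonneg _) ht.2
          linarith [norm_sub_le x (t • y)]
        simp [hx, this]
      · simp [hx]
    refine h1.trans ?_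
    have c0 := (contDiff_partialDeriv hg 0).continuous
    have c1 := (contDiff_partialDeriv hg 1).continuous
    have h2 : eLpNorm D 2 (area (r + ‖y‖)) ≤ ENNReal.ofReal ‖y‖ *
        eLpNorm (fun p => ‖partialDeriv 0 g p‖ + ‖partialDeriv 1 g p‖) 2 (area (r + ‖y‖)) := by
      refine eLpNorm_le_mul_eLpNorm_of_ae_le_mul (Eventually.of_forall fun p => ?_) 2
      simp only [D, fderiv_apply_eq]
      have hy : ∀ i, |y i| ≤ ‖y‖ := fun i => EuclideanSpace.norm_eq y ▸ Real.abs_le_sqrt (by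
        rw [Fin.sum_univ_two]; fin_cases i <;> simp <;> positivity)
      refine (norm_add_le _ _).trans ?_
      rw [norm_mul, norm_mul, Real.norm_of_nonneg (by positivity :
        0 ≤ ‖partialDeriv 0 g p‖ + ‖partialDeriv 1 g p‖), mul_add]
      simp only [PiLp.neg_apply, norm_neg]
      exact add_le_add (mul_le_mul_of_nonneg_right (hy 0) (norm_nonneg _))
        (mul_le_mul_of_nonneg_right (hy 1) (norm_nonneg _))
    refine h2.trans ?_
    rw [ofReal_norm]
    gcongr
    refine (eLpNorm_add_le c0.norm.aestronglyMeasurable c1.norm.aestronglyMeasurable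
      (by norm_num)).trans ?_
    rw [eLpNorm_norm, eLpNorm_norm]

/-- Triangle inequality through G. The error G − F occurs once as it stands and once translated; it
is measured on the whole plane because only there is its norm translation invariant. -/
lemma eLpNorm_translate_sub_le_of_approx {F G : Plane → ℝ} (hF : AEStronglyMeasurable F)
    (hG : AEStronglyMeasurable G) (s : Set Plane) (y : Plane) :
    eLpNorm (fun x => F (x - y) - F x) 2 (volume.restrict s) ≤
      (eLpNorm (G - F) 2 volume + eLpNorm (G - F) 2 volume) +
        eLpNorm (fun x => G (x - y) - G x) 2 (volume.restrict s) := by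
  have hmp : MeasurePreserving (fun x : Plane => x - y) volume volume :=
    measurePreserving_sub_right volume y
  have m1 : AEStronglyMeasurable (G - F) := hG.sub hF
  have m2 : AEStronglyMeasurable ((G - F) ∘ fun x => x - y) := m1.comp_measurePreserving hmp
  have m3 : AEStronglyMeasurable (fun x => G (x - y) - G x) :=
    (hG.comp_measurePreserving hmp).sub hG
  have hsplit : (fun x => F (x - y) - F x) =
      ((G - F) - (G - F) ∘ fun x => x - y) + fun x => G (x - y) - G x := by
    funext x
    simp only [Pi.add_apply, Pi.sub_apply, Function.comp_apply]
    ring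
  rw [hsplit]
  refine (eLpNorm_add_le (m1.sub m2).restrict m3.restrict (by norm_num)).trans
    (add_le_add ?_ le_rfl)
  refine (eLpNorm_mono_measure _ Measure.restrict_le_self).trans ?_
  refine (eLpNorm_sub_le m1 m2 (by norm_num)).trans (add_le_add le_rfl (le_of_eq ?_))
  exact eLpNorm_comp_measurePreserving m1 hmp

/-- Translation estimate for functions with weak derivatives in `L²`. -/
lemma eLpNorm_translate_sub_le {h : L2 R} {k : Fin 2 → L2 R} (H : ∀ i, IsWeakPartial i h (k i))
    {r : ℝ} {y : Plane} (hy : r + ‖y‖ < R) :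
    eLpNorm (fun x => ext h (x - y) - ext h x) 2 (area r) ≤ ‖y‖ₑ * (‖k 0‖ₑ + ‖k 1‖ₑ) := by
  let e : L2 R → ℕ → ℝ≥0∞ := fun f n => eLpNorm (moll n (ext f) - ext f) 2 volume
  have he : ∀ f, Tendsto (e f) atTop (𝓝 0) := fun f => tendsto_moll (ext_measurable f) (ext_memLp f)
  have hm : ∀ (f : L2 R) n, AEStronglyMeasurable (moll n (ext f) - ext f) :=
    fun f n => ((memLp_moll n (ext_measurable f) (ext_memLp f)).sub (ext_memLp f)).1
  -- The smooth estimate for the mollification costs the errors e; they vanish as n → ∞ and leave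
  -- the claimed bound.
  have hlim : Tendsto (fun n => (e h n + e h n) +
      ‖y‖ₑ * ((e (k 0) n + ‖k 0‖ₑ) + (e (k 1) n + ‖k 1‖ₑ))) atTop
      (𝓝 (‖y‖ₑ * (‖k 0‖ₑ + ‖k 1‖ₑ))) := by
    have h1 := ((he (k 0)).add_const ‖k 0‖ₑ).add ((he (k 1)).add_const ‖k 1‖ₑ)
    have h2 := ((he h).add (he h)).add
      (ENNReal.Tendsto.const_mul h1 (Or.inr (enorm_ne_top (x := y))))
    simpa using h2
  refine ge_of_tendsto hlim ?_
  filter_upwards [eventually_inv_lt (sub_pos.2 hy)] with n hn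
  have hg := contDiff_moll n (ext_locallyIntegrable h)
  have hk : ∀ i, eLpNorm (partialDeriv i (moll n (ext h))) 2 (area (r + ‖y‖)) ≤
      e (k i) n + ‖k i‖ₑ := fun i => by
    have h1 : eLpNorm (partialDeriv i (moll n (ext h))) 2 (area (r + ‖y‖)) =
        eLpNorm (moll n (ext (k i))) 2 (area (r + ‖y‖)) := by
      refine eLpNorm_congr_ae ?_
      filter_upwards [ae_restrict_mem disk_measurableSet] with p hp
      exact partialDeriv_moll (H i) (disk_mono (by linarith) hp)
    rw [h1, ← eLpNorm_ext]
    refine (eLpNorm_mono_measure _ Measure.restrict_le_self).trans ?_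
    have h2 : moll n (ext (k i)) = (moll n (ext (k i)) - ext (k i)) + ext (k i) := by simp
    conv_lhs => rw [h2]
    exact eLpNorm_add_le (hm _ _) (ext_memLp _).1 (by norm_num)
  refine (eLpNorm_translate_sub_le_of_approx (ext_memLp h).1 hg.continuous.aestronglyMeasurable
    (disk r) y).trans (add_le_add le_rfl ?_)
  refine (eLpNorm_translate_sub_le_of_smooth hg y).trans ?_
  gcongr
  exacts [hk 0, hk 1]

/-- Mollification error estimate for functions with weak derivatives in `L²`. -/
lemma eLpNorm_moll_sub_le_of_isWeakPartial {h : L2 R} {k : Fin 2 → L2 R}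
    (H : ∀ i, IsWeakPartial i h (k i)) {r : ℝ} {n : ℕ} (hn : r + 1 / ((n : ℝ) + 1) < R) :
    eLpNorm (moll n (ext h) - ext h) 2 (area r) ≤
      ENNReal.ofReal (1 / ((n : ℝ) + 1)) * (‖k 0‖ₑ + ‖k 1‖ₑ) := by
  refine eLpNorm_moll_sub_le n (ext_measurable h) (ext_locallyIntegrable h) fun y hy => ?_
  refine (eLpNorm_translate_sub_le H (by linarith)).trans ?_
  gcongr
  rw [← ofReal_norm]
  exact ENNReal.ofReal_le_ofReal hy

/-! ### The very weak Hessian determinant -/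

lemma integral_linear_combination {α : Type*} [MeasurableSpace α] {μ : Measure α}
    {A B C D E : α → ℝ} (hA : Integrable A μ) (hB : Integrable B μ) (hC : Integrable C μ)
    (hD : Integrable D μ) (hE : Integrable E μ) :
    ∫ p, (A p - 2 * B p + C p + 2 * (D p - E p)) ∂μ =
      (∫ p, A p ∂μ) - 2 * (∫ p, B p ∂μ) + (∫ p, C p ∂μ) +
        2 * ((∫ p, D p ∂μ) - (∫ p, E p ∂μ)) := by
  have h1 : Integrable (fun p => 2 * B p) μ := hB.const_mul 2
  have h2 : Integrable (fun p => A p - 2 * B p) μ := hA.sub h1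
  have h3 : Integrable (fun p => A p - 2 * B p + C p) μ := h2.add hC
  have h4 : Integrable (fun p => D p - E p) μ := hD.sub hE
  have h5 : Integrable (fun p => 2 * (D p - E p)) μ := h4.const_mul 2
  rw [integral_add h3 h5, integral_add h2 hC, integral_sub hA h1, integral_const_mul,
    integral_const_mul, integral_sub hD hE]

/-- The very weak form of the Hessian determinant, for smooth functions. -/
lemma very_weak_det_of_smooth {W η : Plane → ℝ} (hW : ContDiff ℝ ∞ W) (hη : ContDiff ℝ ∞ η)
    (hc : HasCompactSupport η) :
    (∫ p, partialDeriv 0 W p * partialDeriv 0 W p * partialDeriv 1 (partialDeriv 1 η) p)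
      - 2 * (∫ p, partialDeriv 0 W p * partialDeriv 1 W p * partialDeriv 0 (partialDeriv 1 η) p)
      + (∫ p, partialDeriv 1 W p * partialDeriv 1 W p * partialDeriv 0 (partialDeriv 0 η) p) =
    -2 * ((∫ p, partialDeriv 0 (partialDeriv 0 W) p * partialDeriv 1 (partialDeriv 1 W) p * η p)
      - (∫ p, partialDeriv 1 (partialDeriv 0 W) p * partialDeriv 0 (partialDeriv 1 W) p * η p)) := by
  have sW : ∀ i, ContDiff ℝ ∞ (partialDeriv i W) := contDiff_partialDeriv hW
  have sWW : ∀ i j, ContDiff ℝ ∞ (partialDeriv i (partialDeriv j W)) :=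
    fun i j => contDiff_partialDeriv (sW j) i
  have sη : ∀ i, ContDiff ℝ ∞ (partialDeriv i η) := contDiff_partialDeriv hη
  have dW : ∀ i, Differentiable ℝ (partialDeriv i W) := fun i => (sW i).differentiable (by simp)
  have dWW : ∀ i j, Differentiable ℝ (partialDeriv i (partialDeriv j W)) :=
    fun i j => (sWW i j).differentiable (by simp)
  have dη : ∀ i, Differentiable ℝ (partialDeriv i η) := fun i => (sη i).differentiable (by simp)
  have dη' : Differentiable ℝ η := hη.differentiable (by simp)
  have cη : ∀ i, HasCompactSupport (partialDeriv i η) := fun i =>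
    HasCompactSupport.of_support_subset_isCompact hc
      (subset_closure.trans (tsupport_partialDeriv_subset i η))
  have cηη : ∀ i j, HasCompactSupport (partialDeriv i (partialDeriv j η)) := fun i j =>
    HasCompactSupport.of_support_subset_isCompact (cη j)
      (subset_closure.trans (tsupport_partialDeriv_subset i _))
  -- X and Y collect the boundary terms of two integrations by parts: ∂_v X + ∂_u Y is the left
  -- integrand minus the right one, the third derivatives of W cancelling by symmetry.
  let X : Plane → ℝ := fun p => partialDeriv 0 W p * partialDeriv 0 W p * partialDeriv 1 η p
    - partialDeriv 0 W p * partialDeriv 1 W p * partialDeriv 0 η p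
    + (partialDeriv 0 (partialDeriv 0 W) p * partialDeriv 1 W p
      - partialDeriv 0 W p * partialDeriv 1 (partialDeriv 0 W) p) * η p
  let Y : Plane → ℝ := fun p => partialDeriv 1 W p * partialDeriv 1 W p * partialDeriv 0 η p
    - partialDeriv 0 W p * partialDeriv 1 W p * partialDeriv 1 η p
    + (partialDeriv 0 W p * partialDeriv 1 (partialDeriv 1 W) p
      - partialDeriv 1 W p * partialDeriv 1 (partialDeriv 0 W) p) * η p
  have hX : ContDiff ℝ ∞ X :=
    ((((sW 0).mul (sW 0)).mul (sη 1)).sub (((sW 0).mul (sW 1)).mul (sη 0))).add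
      ((((sWW 0 0).mul (sW 1)).sub ((sW 0).mul (sWW 1 0))).mul hη)
  have hY : ContDiff ℝ ∞ Y :=
    ((((sW 1).mul (sW 1)).mul (sη 0)).sub (((sW 0).mul (sW 1)).mul (sη 1))).add
      ((((sW 0).mul (sWW 1 1)).sub ((sW 1).mul (sWW 1 0))).mul hη)
  have cX : HasCompactSupport X :=
    (((cη 1).mul_left).sub ((cη 0).mul_left)).add hc.mul_left
  have cY : HasCompactSupport Y :=
    (((cη 0).mul_left).sub ((cη 1).mul_left)).add hc.mul_left
  have key : ∀ p, partialDeriv 1 X p + partialDeriv 0 Y p =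
      partialDeriv 0 W p * partialDeriv 0 W p * partialDeriv 1 (partialDeriv 1 η) p
      - 2 * (partialDeriv 0 W p * partialDeriv 1 W p * partialDeriv 0 (partialDeriv 1 η) p)
      + partialDeriv 1 W p * partialDeriv 1 W p * partialDeriv 0 (partialDeriv 0 η) p
      + 2 * (partialDeriv 0 (partialDeriv 0 W) p * partialDeriv 1 (partialDeriv 1 W) p * η p
        - partialDeriv 1 (partialDeriv 0 W) p * partialDeriv 0 (partialDeriv 1 W) p * η p) := by
    intro p
    simp (disch := fun_prop) only [X, Y, partialDeriv_add, partialDeriv_sub, partialDeriv_mul]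
    rw [partialDeriv_comm hη 1 0, partialDeriv_comm hW 0 1, partialDeriv_comm (sW 0) 0 1,
      partialDeriv_comm (sW 1) 0 1,
      show partialDeriv 0 (partialDeriv 1 W) = partialDeriv 1 (partialDeriv 0 W) from
        funext fun q => partialDeriv_comm hW 0 1 q]
    ring
  have hi := integral_add
    ((contDiff_partialDeriv hX 1).continuous.integrable_of_hasCompactSupport (μ := volume)
      (HasCompactSupport.of_support_subset_isCompact cX
        (subset_closure.trans (tsupport_partialDeriv_subset 1 X))))
    ((contDiff_partialDeriv hY 0).continuous.integrable_of_hasCompactSupport (μ := volume)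
      (HasCompactSupport.of_support_subset_isCompact cY
        (subset_closure.trans (tsupport_partialDeriv_subset 0 Y))))
  rw [integral_partialDeriv_eq_zero hX cX, integral_partialDeriv_eq_zero hY cY] at hi
  simp only [key] at hi
  have int : ∀ {a b c : Plane → ℝ}, ContDiff ℝ ∞ a → ContDiff ℝ ∞ b → ContDiff ℝ ∞ c →
      HasCompactSupport c → Integrable (fun p => a p * b p * c p) := fun ha hb hc' hcs =>
    (((ha.mul hb).mul hc').continuous).integrable_of_hasCompactSupport hcs.mul_left
  have i1 := int (sW 0) (sW 0) (contDiff_partialDeriv (sη 1) 1) (cηη 1 1)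
  have i2 := int (sW 0) (sW 1) (contDiff_partialDeriv (sη 1) 0) (cηη 0 1)
  have i3 := int (sW 1) (sW 1) (contDiff_partialDeriv (sη 0) 0) (cηη 0 0)
  have i4 := int (sWW 0 0) (sWW 1 1) hη hc
  have i5 := int (sWW 1 0) (sWW 0 1) hη hc
  rw [integral_linear_combination i1 i2 i3 i4 i5] at hi
  linarith

/-- The second weak derivative `∂ⱼ∂ᵢω` of an element of `W^{2,2}`. -/
def W22.dd (w : W22 R) (i j : Fin 2) : L2 R := w.1.2.2 i j

lemma W22.isWeakPartial_fn (w : W22 R) (i : Fin 2) : IsWeakPartial i (W22.fn w) (W22.d w i) := w.2.1 i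

lemma W22.isWeakPartial_d (w : W22 R) (i j : Fin 2) : IsWeakPartial j (W22.d w i) (W22.dd w i j) := w.2.2 i j

lemma IsTest.bounded {η : Plane → ℝ} (hη : IsTest R η) : ∃ C, ∀ p, ‖η p‖ ≤ C :=
  hη.compact.exists_bound_of_continuous hη.smooth.continuous

lemma integral_ext_mul_ext_mul (h k : L2 R) (ψ : Plane → ℝ) :
    ∫ p, ext h p * ext k p * ψ p = ∫ p, h p * k p * ψ p ∂(area R) := by
  rw [← integral_area_eq_of_support (R := R) (fun p hp => by simp [ext, hp])]
  refine integral_congr_ae ?_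
  filter_upwards [ext_ae h, ext_ae k] with p h1 h2
  rw [h1, h2]

lemma tendsto_integral_moll_mul (h k : L2 R) {η : Plane → ℝ} (hη : IsTest R η) :
    Tendsto (fun n => ∫ p, moll n (ext h) p * moll n (ext k) p * η p) atTop
      (𝓝 (∫ p, h p * k p * η p ∂(area R))) := by
  obtain ⟨C, hC⟩ := hη.bounded
  rw [← integral_ext_mul_ext_mul]
  exact tendsto_integral_mul_mul (fun n => memLp_moll n (ext_measurable h) (ext_memLp h))
    (fun n => memLp_moll n (ext_measurable k) (ext_memLp k)) (ext_memLp h) (ext_memLp k)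
    (tendsto_moll (ext_measurable h) (ext_memLp h)) (tendsto_moll (ext_measurable k) (ext_memLp k))
    hη.smooth.continuous.aestronglyMeasurable hC

/-- On a smaller disk the derivatives of the mollified function are the mollified derivatives. -/
lemma W22.partialDeriv_partialDeriv_moll (w : W22 R) (n : ℕ) (i j : Fin 2) :
    Set.EqOn (partialDeriv j (partialDeriv i (moll n (ext (W22.fn w))))) (moll n (ext (W22.dd w i j)))
      (disk (R - 1 / ((n : ℝ) + 1))) :=
  (partialDeriv_eqOn_of_isOpen Metric.isOpen_ball (partialDeriv_moll (W22.isWeakPartial_fn w i))).trans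
    (partialDeriv_moll (W22.isWeakPartial_d w i j))

/-- The very weak form of the Hessian determinant on `W^{2,2}`. -/
lemma very_weak_det (hR : 0 < R) (w : W22 R) {η : Plane → ℝ} (hη : IsTest R η) :
    (∫ p, W22.d w 0 p * W22.d w 0 p * partialDeriv 1 (partialDeriv 1 η) p ∂(area R))
      - 2 * (∫ p, W22.d w 0 p * W22.d w 1 p * partialDeriv 0 (partialDeriv 1 η) p ∂(area R))
      + (∫ p, W22.d w 1 p * W22.d w 1 p * partialDeriv 0 (partialDeriv 0 η) p ∂(area R)) =
    -2 * ((∫ p, W22.dd w 0 0 p * W22.dd w 1 1 p * η p ∂(area R))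
      - (∫ p, W22.dd w 0 1 p * W22.dd w 1 0 p * η p ∂(area R))) := by
  obtain ⟨r, -, hrR, hr⟩ := hη.exists_radius hR
  have hl := ((tendsto_integral_moll_mul (W22.d w 0) (W22.d w 0) ((hη.partialDeriv 1).partialDeriv 1)).sub
    ((tendsto_integral_moll_mul (W22.d w 0) (W22.d w 1)
      ((hη.partialDeriv 1).partialDeriv 0)).const_mul 2)).add
    (tendsto_integral_moll_mul (W22.d w 1) (W22.d w 1) ((hη.partialDeriv 0).partialDeriv 0))
  have hr' := ((tendsto_integral_moll_mul (W22.dd w 0 0) (W22.dd w 1 1) hη).sub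
    (tendsto_integral_moll_mul (W22.dd w 0 1) (W22.dd w 1 0) hη)).const_mul (-2)
  -- Both sides converge under mollification. For large n the support of η lies where mollification
  -- commutes with the weak derivatives, so the smooth identity equates the two sequences.
  refine tendsto_nhds_unique hl (hr'.congr' ?_)
  filter_upwards [eventually_inv_lt (sub_pos.2 hrR)] with n hn
  have hsub : disk r ⊆ disk (R - 1 / ((n : ℝ) + 1)) := disk_mono (by linarith)
  have hs := very_weak_det_of_smooth (contDiff_moll n (ext_locallyIntegrable (W22.fn w))) hη.smooth
    hη.compact
  have e : ∀ {a b a' b' ψ : Plane → ℝ}, Set.EqOn a a' (disk (R - 1 / ((n : ℝ) + 1))) →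
      Set.EqOn b b' (disk (R - 1 / ((n : ℝ) + 1))) → tsupport ψ ⊆ tsupport η →
      ∫ p, a p * b p * ψ p = ∫ p, a' p * b' p * ψ p := by
    intro a b a' b' ψ ha hb hψ
    congr 1
    funext p
    by_cases hp : p ∈ tsupport ψ
    · rw [ha (hsub (hr (hψ hp))), hb (hsub (hr (hψ hp)))]
    · simp [image_eq_zero_of_notMem_tsupport hp]
  have t : ∀ i j, tsupport (partialDeriv i (partialDeriv j η)) ⊆ tsupport η := fun i j =>
    (tsupport_partialDeriv_subset i _).trans (tsupport_partialDeriv_subset j _)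
  have e1 := fun i => partialDeriv_moll (n := n) (W22.isWeakPartial_fn w i)
  have e2 := W22.partialDeriv_partialDeriv_moll w n
  rw [e (e1 0) (e1 0) (t 1 1), e (e1 0) (e1 1) (t 0 1), e (e1 1) (e1 1) (t 0 0),
    e (e2 0 0) (e2 1 1) subset_rfl, e (e2 0 1) (e2 1 0) subset_rfl] at hs
  exact hs.symm

lemma integrable_mul_mul (h k : L2 R) {ψ : Plane → ℝ} (hψ : IsTest R ψ) :
    Integrable (fun p => h p * k p * ψ p) (area R) := by
  obtain ⟨C, hC⟩ := hψ.bounded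
  exact ((Lp.memLp h).integrable_mul (Lp.memLp k)).mul_bdd hψ.smooth.continuous.aestronglyMeasurable
    (Eventually.of_forall hC)

lemma integrable_mul_test (h : L2 R) {ψ : Plane → ℝ} (hψ : IsTest R ψ) :
    Integrable (fun p => h p * ψ p) (area R) :=
  integrable_mul_of_hasCompactSupport h hψ.smooth.continuous hψ.compact

lemma IsTest.integrable_mul {ψ χ : Plane → ℝ} (hψ : IsTest R ψ) (hχ : ContDiff ℝ ∞ χ) :
    Integrable (fun p => χ p * ψ p) :=
  (hψ.mul_left hχ).smooth.continuous.integrable_of_hasCompactSupport (hψ.mul_left hχ).compact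

/-! ### Hessian algebra and the compatibility of strains -/

lemma W22.hessian_det (w : W22 R) (p : Plane) : (W22.hessian w p).det =
    W22.dd w 0 0 p * W22.dd w 1 1 p - W22.dd w 0 1 p * W22.dd w 1 0 p := by
  rw [Matrix.det_fin_two]; rfl

lemma W22.hessianNormSq_eq (w : W22 R) (p : Plane) : W22.hessianNormSq w p =
    W22.dd w 0 0 p ^ 2 + W22.dd w 0 1 p ^ 2 + (W22.dd w 1 0 p ^ 2 + W22.dd w 1 1 p ^ 2) := by
  simp only [W22.hessianNormSq, Fin.sum_univ_two]; rfl

lemma W22.hessianNormSq_nonneg (w : W22 R) (p : Plane) : 0 ≤ W22.hessianNormSq w p := by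
  rw [W22.hessianNormSq_eq]; positivity

/-- Source of the lower bound and of its equality case. Symmetry of the weak Hessian is not
presupposed, so its antisymmetric part appears as a second square and vanishes with the trace at
equality. -/
lemma W22.hessianNormSq_add_det (w : W22 R) (p : Plane) :
    W22.hessianNormSq w p + 2 * (W22.hessian w p).det =
      (W22.dd w 0 0 p + W22.dd w 1 1 p) ^ 2 + (W22.dd w 0 1 p - W22.dd w 1 0 p) ^ 2 := by
  rw [W22.hessianNormSq_eq, W22.hessian_det]; ring

lemma W22.integrable_det (w : W22 R) : Integrable (fun p => (W22.hessian w p).det) (area R) := by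
  simp only [W22.hessian_det]
  exact ((Lp.memLp _).integrable_mul (Lp.memLp _)).sub ((Lp.memLp _).integrable_mul (Lp.memLp _))

lemma W22.integrable_hessianNormSq (w : W22 R) : Integrable (W22.hessianNormSq w) (area R) := by
  have : W22.hessianNormSq w = fun p => W22.dd w 0 0 p ^ 2 + W22.dd w 0 1 p ^ 2 +
      (W22.dd w 1 0 p ^ 2 + W22.dd w 1 1 p ^ 2) := funext (W22.hessianNormSq_eq w)
  rw [this]
  have h : ∀ i j, Integrable (fun p => W22.dd w i j p ^ 2) (area R) :=
    fun i j => (Lp.memLp _).integrable_sq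
  exact ((h 0 0).add (h 0 1)).add ((h 1 0).add (h 1 1))

lemma bending_eq (w : W22 R) :
    bending w = ENNReal.ofReal (∫ p, W22.hessianNormSq w p ∂(area R)) := by
  rw [bending, ofReal_integral_eq_lintegral_ofReal (W22.integrable_hessianNormSq w)
    (Eventually.of_forall (W22.hessianNormSq_nonneg w))]

/-- Integrating each of the three terms by parts twice contributes 2 ∫ η. This is where the −1 of
the Monge-Ampère equation originates: the polynomial parts of the strains are −1/3 of these
coefficients, giving −2 ∫ η. -/
lemma integral_quadratic_test {η : Plane → ℝ} (hη : IsTest R η) :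
    ∫ p : Plane, (p 1 ^ 2 * partialDeriv 1 (partialDeriv 1 η) p
      + 2 * p 0 * p 1 * partialDeriv 0 (partialDeriv 1 η) p
      + p 0 ^ 2 * partialDeriv 0 (partialDeriv 0 η) p) = 6 * ∫ p, η p := by
  have c := contDiff_coord
  have dc : ∀ j, Differentiable ℝ (fun q : Plane => q j) := fun j => (c j).differentiable (by simp)
  have sη : ∀ i, ContDiff ℝ ∞ (partialDeriv i η) := fun i => (hη.partialDeriv i).smooth
  have dη : ∀ i, Differentiable ℝ (partialDeriv i η) := fun i => (sη i).differentiable (by simp)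
  have dη' : Differentiable ℝ η := hη.smooth.differentiable (by simp)
  let X : Plane → ℝ := fun p => p 1 * p 1 * partialDeriv 1 η p - 4 * p 1 * η p
  let Y : Plane → ℝ := fun p => 2 * p 0 * p 1 * partialDeriv 1 η p
    + (p 0 * p 0 * partialDeriv 0 η p - 2 * p 0 * η p)
  have hX : ContDiff ℝ ∞ X := (((c 1).mul (c 1)).mul (sη 1)).sub
    ((contDiff_const.mul (c 1)).mul hη.smooth)
  have hY : ContDiff ℝ ∞ Y := (((contDiff_const.mul (c 0)).mul (c 1)).mul (sη 1)).add
    ((((c 0).mul (c 0)).mul (sη 0)).sub ((contDiff_const.mul (c 0)).mul hη.smooth))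
  have cX : HasCompactSupport X :=
    ((hη.partialDeriv 1).compact.mul_left).sub hη.compact.mul_left
  have cY : HasCompactSupport Y := ((hη.partialDeriv 1).compact.mul_left).add
    (((hη.partialDeriv 0).compact.mul_left).sub hη.compact.mul_left)
  have key : ∀ p : Plane, p 1 ^ 2 * partialDeriv 1 (partialDeriv 1 η) p
      + 2 * p 0 * p 1 * partialDeriv 0 (partialDeriv 1 η) p
      + p 0 ^ 2 * partialDeriv 0 (partialDeriv 0 η) p =
      (partialDeriv 1 X p + partialDeriv 0 Y p) + 6 * η p := by
    intro p
    simp (disch := fun_prop) only [X, Y, partialDeriv_add, partialDeriv_sub, partialDeriv_mul,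
      partialDeriv_coord, partialDeriv_const]
    simp
    ring
  have iX : Integrable (partialDeriv 1 X) :=
    (contDiff_partialDeriv hX 1).continuous.integrable_of_hasCompactSupport
      (HasCompactSupport.of_support_subset_isCompact cX
        (subset_closure.trans (tsupport_partialDeriv_subset 1 X)))
  have iY : Integrable (partialDeriv 0 Y) :=
    (contDiff_partialDeriv hY 0).continuous.integrable_of_hasCompactSupport
      (HasCompactSupport.of_support_subset_isCompact cY
        (subset_closure.trans (tsupport_partialDeriv_subset 0 Y)))
  have iη : Integrable (fun p => 6 * η p) :=
    (hη.smooth.continuous.integrable_of_hasCompactSupport hη.compact).const_mul 6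
  have iXY : Integrable (fun p => partialDeriv 1 X p + partialDeriv 0 Y p) := iX.add iY
  simp only [key]
  rw [integral_add iXY iη, integral_add iX iY, integral_partialDeriv_eq_zero hX cX,
    integral_partialDeriv_eq_zero hY cY, integral_const_mul]
  simp

/-- The derivatives are moved to the test function, where third derivatives commute. This is the
cancellation of f and g in the strain combination. -/
lemma W12.integral_d_comm (f : W12 R) {η : Plane → ℝ} (hη : IsTest R η) (i j k : Fin 2) :
    ∫ p, W12.d f k p * partialDeriv i (partialDeriv j η) p ∂(area R) =
      ∫ p, W12.d f j p * partialDeriv i (partialDeriv k η) p ∂(area R) := by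
  have h1 := f.2 k _ ((hη.partialDeriv j).partialDeriv i)
  have h2 := f.2 j _ ((hη.partialDeriv k).partialDeriv i)
  have e : ∀ p, partialDeriv k (partialDeriv i (partialDeriv j η)) p =
      partialDeriv j (partialDeriv i (partialDeriv k η)) p := fun p => by
    rw [partialDeriv_comm (hη.partialDeriv j).smooth, partialDeriv_comm (hη.partialDeriv k).smooth j,
      show partialDeriv k (partialDeriv j η) = partialDeriv j (partialDeriv k η) from
        funext fun q => partialDeriv_comm hη.smooth k j q]
  simp only [e] at h1
  have := h1.symm.trans h2
  exact neg_inj.1 this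

/-- The strains determine the Hessian determinant in the very weak sense. -/
lemma very_weak_strain (hR : 0 < R) (x : Config R) {η : Plane → ℝ} (hη : IsTest R η) :
    ∫ p, (strain11 x p * partialDeriv 1 (partialDeriv 1 η) p
      - 2 * (strain12 x p * partialDeriv 0 (partialDeriv 1 η) p)
      + strain22 x p * partialDeriv 0 (partialDeriv 0 η) p) ∂(area R) =
    -2 * ∫ p, ((W22.hessian (Config.ω x) p).det + 1) * η p ∂(area R) := by
  have t := fun i j => (hη.partialDeriv j).partialDeriv i
  set w := Config.ω x with hw
  set f := Config.f x with hf
  set g := Config.g x with hg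
  let P : Plane → ℝ := fun p => p 1 ^ 2 * partialDeriv 1 (partialDeriv 1 η) p
      + 2 * p 0 * p 1 * partialDeriv 0 (partialDeriv 1 η) p
      + p 0 ^ 2 * partialDeriv 0 (partialDeriv 0 η) p
  have c := contDiff_coord
  have iP : Integrable P (area R) := by
    refine Integrable.restrict ?_
    exact (((t 1 1).integrable_mul ((c 1).pow 2)).add
      ((t 0 1).integrable_mul ((contDiff_const.mul (c 0)).mul (c 1)))).add
      ((t 0 0).integrable_mul ((c 0).pow 2))
  have hP : ∫ p, P p ∂(area R) = 6 * ∫ p, η p ∂(area R) := by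
    rw [integral_area_eq_of_support (fun p hp => hη.eq_zero_of_notMem hp),
      ← integral_quadratic_test hη, integral_area_eq_of_support (fun p hp => by
        simp [P, (t 1 1).eq_zero_of_notMem hp, (t 0 1).eq_zero_of_notMem hp,
          (t 0 0).eq_zero_of_notMem hp])]
  have if0 := integrable_mul_test (W12.d f 0) (t 1 1)
  have if1 := integrable_mul_test (W12.d f 1) (t 0 1)
  have ig0 := integrable_mul_test (W12.d g 0) (t 0 1)
  have ig1 := integrable_mul_test (W12.d g 1) (t 0 0)
  have iD : Integrable (fun p => W12.d f 0 p * partialDeriv 1 (partialDeriv 1 η) p +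
    W12.d g 1 p * partialDeriv 0 (partialDeriv 0 η) p) (area R) := if0.add ig1
  have iE1 : Integrable (fun p => W12.d f 1 p * partialDeriv 0 (partialDeriv 1 η) p +
    W12.d g 0 p * partialDeriv 0 (partialDeriv 1 η) p) (area R) := if1.add ig0
  have iE2 : Integrable (fun p => 1 / 6 * P p) (area R) := iP.const_mul _
  have iE : Integrable (fun p => (W12.d f 1 p * partialDeriv 0 (partialDeriv 1 η) p +
    W12.d g 0 p * partialDeriv 0 (partialDeriv 1 η) p) + 1 / 6 * P p) (area R) := iE1.add iE2
  -- The last group carries the factor 2, so P enters with 1/6 to produce the coefficient 1/3 of the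
  -- strains.
  have hlin := integral_linear_combination
    (integrable_mul_mul (W22.d w 0) (W22.d w 0) (t 1 1))
    (integrable_mul_mul (W22.d w 0) (W22.d w 1) (t 0 1))
    (integrable_mul_mul (W22.d w 1) (W22.d w 1) (t 0 0)) iD iE
  rw [very_weak_det hR w hη, integral_add if0 ig1, integral_add iE1 iE2, integral_add if1 ig0,
    integral_const_mul, hP] at hlin
  have hcf : ∫ p, W12.d f 0 p * partialDeriv 1 (partialDeriv 1 η) p ∂(area R) =
      ∫ p, W12.d f 1 p * partialDeriv 0 (partialDeriv 1 η) p ∂(area R) := by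
    rw [W12.integral_d_comm f hη 1 1 0]
    simp only [partialDeriv_comm hη.smooth 1 0]
  have hcg := W12.integral_d_comm g hη 0 1 0
  have iη : Integrable η (area R) :=
    (hη.smooth.continuous.integrable_of_hasCompactSupport hη.compact).restrict
  have hdet : ∫ p, ((W22.hessian w p).det + 1) * η p ∂(area R) =
      ((∫ p, W22.dd w 0 0 p * W22.dd w 1 1 p * η p ∂(area R))
      - (∫ p, W22.dd w 0 1 p * W22.dd w 1 0 p * η p ∂(area R))) + ∫ p, η p ∂(area R) := by
    have i1 := integrable_mul_mul (W22.dd w 0 0) (W22.dd w 1 1) hη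
    have i2 := integrable_mul_mul (W22.dd w 0 1) (W22.dd w 1 0) hη
    have i3 : Integrable (fun p => W22.dd w 0 0 p * W22.dd w 1 1 p * η p -
      W22.dd w 0 1 p * W22.dd w 1 0 p * η p) (area R) := i1.sub i2
    rw [← integral_sub i1 i2, ← integral_add i3 iη]
    congr 1
    funext p
    rw [W22.hessian_det]
    ring
  rw [hdet]
  refine Eq.trans (integral_congr_ae (Eventually.of_forall fun p => ?_)) (hlin.trans ?_)
  · simp only [strain11, strain12, strain22, P, ← hw, ← hf, ← hg]
    ring
  · rw [hcf, hcg]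
    ring

lemma strain_measurable (x : Config R) :
    Measurable (strain11 x) ∧ Measurable (strain12 x) ∧ Measurable (strain22 x) := by
  have m : ∀ h : L2 R, Measurable h := fun h => (Lp.stronglyMeasurable h).measurable
  have c : ∀ j, Measurable (fun q : Plane => q j) := fun j => (contDiff_coord j).continuous.measurable
  refine ⟨?_, ?_, ?_⟩
  · exact (((m _).const_mul 2).add ((m _).pow_const 2)).sub (((c 1).pow_const 2).div_const 3)
  · exact (((m _).add (m _)).add ((m _).mul (m _))).add (((c 0).mul (c 1)).div_const 3)
  · exact (((m _).const_mul 2).add ((m _).pow_const 2)).sub (((c 0).pow_const 2).div_const 3)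

lemma integrable_of_continuous {ψ : Plane → ℝ} (hψ : Continuous ψ) : Integrable ψ (area R) :=
  (memLp_of_continuous hψ).integrable (by norm_num)

lemma strain_integrable (x : Config R) : Integrable (strain11 x) (area R) ∧
    Integrable (strain12 x) (area R) ∧ Integrable (strain22 x) (area R) := by
  have m : ∀ h : L2 R, Integrable h (area R) := fun h => (Lp.memLp h).integrable (by norm_num)
  have s : ∀ h : L2 R, Integrable (fun p => h p ^ 2) (area R) := fun h => (Lp.memLp h).integrable_sq
  have q : ∀ h k : L2 R, Integrable (fun p => h p * k p) (area R) :=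
    fun h k => (Lp.memLp h).integrable_mul (Lp.memLp k)
  have c : ∀ j, Continuous (fun q : Plane => q j) := fun j => (contDiff_coord j).continuous
  refine ⟨?_, ?_, ?_⟩
  · exact (((m _).const_mul 2).add (s _)).sub
      (integrable_of_continuous (((c 1).pow 2).div_const 3))
  · exact (((m _).add (m _)).add (q _ _)).add
      (integrable_of_continuous (((c 0).mul (c 1)).div_const 3))
  · exact (((m _).const_mul 2).add (s _)).sub
      (integrable_of_continuous (((c 0).pow 2).div_const 3))

/-- Small-slopes isometries solve the Monge-Ampère equation. -/
lemma IsIsometric.solvesMongeAmpere (hR : 0 < R) {x : Config R} (hx : IsIsometric x) :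
    SolvesMongeAmpere (Config.ω x) := by
  have h := ae_eq_zero_of_forall_test (R := R)
    (F := fun p => (W22.hessian (Config.ω x) p).det + 1)
    ((W22.integrable_det _).add (integrable_const 1)) fun η hη => by
      have h1 := very_weak_strain hR x hη
      have h2 : ∫ p, (strain11 x p * partialDeriv 1 (partialDeriv 1 η) p
          - 2 * (strain12 x p * partialDeriv 0 (partialDeriv 1 η) p)
          + strain22 x p * partialDeriv 0 (partialDeriv 0 η) p) ∂(area R) = 0 := by
        rw [← integral_zero Plane ℝ (μ := area R)]
        refine integral_congr_ae ?_
        filter_upwards [hx] with p ⟨a, b, c⟩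
        simp [a, b, c]
      linarith
  filter_upwards [h] with p hp
  linarith

/-! ### Lower bounds for the energies -/

lemma area_univ (hR : 0 < R) : (area R) Set.univ = ENNReal.ofReal (Real.pi * R ^ 2) := by
  rw [area, Measure.restrict_apply_univ, disk, EuclideanSpace.volume_ball_fin_two,
    ← ENNReal.ofReal_pow hR.le, ← ENNReal.ofReal_mul (by positivity), mul_comm]

lemma SolvesMongeAmpere.two_le {w : W22 R} (hw : SolvesMongeAmpere w) :
    ∀ᵐ p ∂(area R), 2 ≤ W22.hessianNormSq w p := by
  filter_upwards [hw] with p hp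
  have := W22.hessianNormSq_add_det w p
  rw [hp] at this
  nlinarith [sq_nonneg (W22.dd w 0 0 p + W22.dd w 1 1 p), sq_nonneg (W22.dd w 0 1 p - W22.dd w 1 0 p)]

lemma SolvesMongeAmpere.le_bending (hR : 0 < R) {w : W22 R} (hw : SolvesMongeAmpere w) :
    ENNReal.ofReal (2 * Real.pi * R ^ 2) ≤ bending w := by
  calc ENNReal.ofReal (2 * Real.pi * R ^ 2) = ∫⁻ _, ENNReal.ofReal 2 ∂(area R) := by
        rw [lintegral_const, area_univ hR, ← ENNReal.ofReal_mul (by norm_num), mul_assoc]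
    _ ≤ bending w := by
        refine lintegral_mono_ae ?_
        filter_upwards [hw.two_le] with p hp using ENNReal.ofReal_le_ofReal hp

/-- For integrands without a sign, such as the lower bound for the energy density below: dropping
the negative part only increases the integral. -/
lemma ofReal_integral_le_lintegral {α : Type*} [MeasurableSpace α] {μ : Measure α} {f : α → ℝ}
    (hf : Integrable f μ) : ENNReal.ofReal (∫ p, f p ∂μ) ≤ ∫⁻ p, ENNReal.ofReal (f p) ∂μ := by
  rw [integral_eq_lintegral_pos_part_sub_lintegral_neg_part hf]
  refine (ENNReal.ofReal_le_ofReal (sub_le_self _ ENNReal.toReal_nonneg)).trans ?_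
  exact ENNReal.ofReal_toReal_le

/-- Lower bound for the rescaled energy. -/
lemma le_F (hR : 0 < R) {η : Plane → ℝ} (hη : IsTest R η) (h0 : ∀ p, 0 ≤ η p)
    (h1 : ∀ p, η p ≤ 1) : ∃ C : ℝ, ∀ t : ℝ, 0 < t → ∀ x : Config R,
      ENNReal.ofReal (2 * ∫ p, η p ∂(area R) - t ^ 2 * C) ≤ F t x := by
  have t' := fun i j => (hη.partialDeriv j).partialDeriv i
  -- The weights 1, 2, 1 match the stretching density, and the factor 1/4 is the remainder left by
  -- completing squares.
  let Ψ : Plane → ℝ := fun p => (partialDeriv 1 (partialDeriv 1 η) p ^ 2 +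
    2 * partialDeriv 0 (partialDeriv 1 η) p ^ 2 + partialDeriv 0 (partialDeriv 0 η) p ^ 2) / 4
  have hΨc : Continuous Ψ := by
    have a := fun i j => (t' i j).smooth.continuous
    exact ((((a 1 1).pow 2).add (continuous_const.mul ((a 0 1).pow 2))).add
      ((a 0 0).pow 2)).div_const 4
  have iΨ : Integrable Ψ (area R) := integrable_of_continuous hΨc
  refine ⟨∫ p, Ψ p ∂(area R), fun t ht x => ?_⟩
  set w := Config.ω x with hw
  obtain ⟨m1, m2, m3⟩ := strain_measurable x
  obtain ⟨s1, s2, s3⟩ := strain_integrable x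
  let A : Plane → ℝ := fun p => strain11 x p * partialDeriv 1 (partialDeriv 1 η) p
      - 2 * (strain12 x p * partialDeriv 0 (partialDeriv 1 η) p)
      + strain22 x p * partialDeriv 0 (partialDeriv 0 η) p
  have bd : ∀ {h ψ : Plane → ℝ}, Integrable h (area R) → IsTest R ψ →
      Integrable (fun p => h p * ψ p) (area R) := fun hh hψ => by
    obtain ⟨C, hC⟩ := hψ.bounded
    exact hh.mul_bdd hψ.smooth.continuous.aestronglyMeasurable (Eventually.of_forall hC)
  have iA : Integrable A (area R) :=
    ((bd s1 (t' 1 1)).sub ((bd s2 (t' 0 1)).const_mul 2)).add (bd s3 (t' 0 0))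
  have iη : Integrable η (area R) := integrable_of_continuous hη.smooth.continuous
  have id : Integrable (fun p => (W22.hessian w p).det * η p) (area R) := bd (W22.integrable_det w) hη
  have id1 : Integrable (fun p => ((W22.hessian w p).det + 1) * η p) (area R) :=
    bd ((W22.integrable_det w).add (integrable_const 1)) hη
  have hA : ∫ p, A p ∂(area R) = -2 * ((∫ p, (W22.hessian w p).det * η p ∂(area R)) +
      ∫ p, η p ∂(area R)) := by
    rw [← integral_add id iη, very_weak_strain hR x hη]
    simp only [add_mul, one_mul, ← hw]
  -- A pointwise lower bound for the density of S + t² 𝔅. Its integral no longer depends on the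
  -- configuration: by `very_weak_strain` the determinant terms cancel.
  let L : Plane → ℝ := fun p => t ^ 2 * (-(A p) - 2 * ((W22.hessian w p).det * η p)
    - t ^ 2 * Ψ p)
  have iL1 : Integrable (fun p => -(A p)) (area R) := iA.neg
  have iL2 : Integrable (fun p => 2 * ((W22.hessian w p).det * η p)) (area R) := id.const_mul 2
  have iL3 : Integrable (fun p => -(A p) - 2 * ((W22.hessian w p).det * η p)) (area R) :=
    iL1.sub iL2
  have iL4 : Integrable (fun p => t ^ 2 * Ψ p) (area R) := iΨ.const_mul _
  have iL : Integrable L (area R) := (iL3.sub iL4).const_mul _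
  have hL : ∫ p, L p ∂(area R) =
      t ^ 2 * (2 * ∫ p, η p ∂(area R) - t ^ 2 * ∫ p, Ψ p ∂(area R)) := by
    rw [integral_const_mul, integral_sub iL3 iL4, integral_sub iL1 iL2, integral_neg, hA,
      integral_const_mul, integral_const_mul]
    ring
  have ht2 : 0 < t ^ 2 := by positivity
  rw [F, ENNReal.le_div_iff_mul_le (Or.inl (by simpa using ht.ne')) (Or.inl ENNReal.ofReal_ne_top),
    mul_comm, ← ENNReal.ofReal_mul ht2.le, ← hL]
  refine (ofReal_integral_le_lintegral iL).trans ?_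
  have mS : Measurable fun p => ENNReal.ofReal
      ((strain11 x p) ^ 2 + 2 * (strain12 x p) ^ 2 + (strain22 x p) ^ 2) :=
    (((m1.pow_const 2).add ((m2.pow_const 2).const_mul 2)).add (m3.pow_const 2)).ennreal_ofReal
  rw [elastic, stretching, bending, ← lintegral_const_mul' _ _ ENNReal.ofReal_ne_top,
    ← lintegral_add_left mS]
  refine lintegral_mono fun p => ?_
  rw [← ENNReal.ofReal_mul ht2.le, ← ENNReal.ofReal_add (by positivity)
    (mul_nonneg ht2.le (W22.hessianNormSq_nonneg _ _))]
  refine ENNReal.ofReal_le_ofReal ?_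
  have hH := W22.hessianNormSq_add_det w p
  have hn := W22.hessianNormSq_nonneg w p
  -- Split ‖D²ω‖² with weights η and 1 − η: the first part dominates −2 η det D²ω, the second is
  -- nonnegative.
  have hb : -(2 * ((W22.hessian w p).det * η p)) ≤ W22.hessianNormSq w p := by
    have h2 : 0 ≤ W22.hessianNormSq w p + 2 * (W22.hessian w p).det := by rw [hH]; positivity
    nlinarith [mul_nonneg h2 (h0 p), mul_nonneg hn (sub_nonneg.2 (h1 p))]
  simp only [L, A, Ψ, ← hw]
  have hb' := mul_le_mul_of_nonneg_left hb ht2.le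
  -- The three completed squares absorb the linear strain terms of A; the mixed one is used with
  -- weight 2 and the opposite sign.
  nlinarith [sq_nonneg (strain11 x p + t ^ 2 * partialDeriv 1 (partialDeriv 1 η) p / 2),
    sq_nonneg (strain12 x p - t ^ 2 * partialDeriv 0 (partialDeriv 1 η) p / 2),
    sq_nonneg (strain22 x p + t ^ 2 * partialDeriv 0 (partialDeriv 0 η) p / 2)]

/-- As r increases to R the area πr² tends to πR², so a bump equal to 1 on a slightly smaller disk
suffices. -/
lemma exists_cutoff (hR : 0 < R) {c : ℝ} (hc : c < 2 * Real.pi * R ^ 2) :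
    ∃ η : Plane → ℝ, IsTest R η ∧ (∀ p, 0 ≤ η p) ∧ (∀ p, η p ≤ 1) ∧
      c < 2 * ∫ p, η p ∂(area R) := by
  have hcont : Tendsto (fun r : ℝ => 2 * Real.pi * r ^ 2) (𝓝[<] R) (𝓝 (2 * Real.pi * R ^ 2)) :=
    ((by fun_prop : Continuous fun r : ℝ => 2 * Real.pi * r ^ 2).tendsto R).mono_left
      nhdsWithin_le_nhds
  obtain ⟨r, hcr, hr0, hrR⟩ := ((hcont.eventually (lt_mem_nhds hc)).and
    (Ioo_mem_nhdsLT hR)).exists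
  let b : ContDiffBump (0 : Plane) := ⟨r, (r + R) / 2, hr0, by linarith⟩
  have hb : IsTest R b := ⟨b.contDiff, b.hasCompactSupport, by
    rw [b.tsupport_eq]
    exact Metric.closedBall_subset_ball (by simp only [b]; linarith)⟩
  refine ⟨b, hb, fun p => b.nonneg, fun p => b.le_one, hcr.trans_le ?_⟩
  have h1 : ∫ p, (disk r).indicator (fun _ => (1 : ℝ)) p ∂(area R) = Real.pi * r ^ 2 := by
    rw [integral_indicator disk_measurableSet, setIntegral_const, area,
      measureReal_restrict_apply disk_measurableSet, Set.inter_eq_left.2 (disk_mono hrR.le),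
      Measure.real, disk, EuclideanSpace.volume_ball_fin_two]
    simp [ENNReal.toReal_ofReal, hr0.le, Real.pi_nonneg, mul_comm]
  have h2 : Real.pi * r ^ 2 ≤ ∫ p, b p ∂(area R) := by
    rw [← h1]
    refine integral_mono ((integrable_const 1).indicator disk_measurableSet)
      (integrable_of_continuous b.continuous) fun p => ?_
    by_cases hp : p ∈ disk r
    · simp only [hp, Set.indicator_of_mem]
      exact (b.one_of_mem_closedBall (Metric.ball_subset_closedBall hp)).ge
    · simpa [hp] using b.nonneg
  linarith

/-- Uniform lower bound for the rescaled energies as the thickness tends to zero. -/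
lemma eventually_le_F (hR : 0 < R) {c : ℝ} (hc : c < 2 * Real.pi * R ^ 2) :
    ∀ᶠ t : ℝ in 𝓝[>] 0, ∀ x : Config R, ENNReal.ofReal c ≤ F t x := by
  obtain ⟨η, hη, h0, h1, hcη⟩ := exists_cutoff hR hc
  obtain ⟨C, hC⟩ := le_F hR hη h0 h1
  have hcont : Tendsto (fun t : ℝ => 2 * ∫ p, η p ∂(area R) - t ^ 2 * C) (𝓝[>] 0)
      (𝓝 (2 * ∫ p, η p ∂(area R) - 0 ^ 2 * C)) :=
    ((by fun_prop : Continuous fun t : ℝ => 2 * ∫ p, η p ∂(area R) - t ^ 2 * C).tendsto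
      0).mono_left nhdsWithin_le_nhds
  filter_upwards [hcont.eventually (lt_mem_nhds (by simpa using hcη)), self_mem_nhdsWithin]
    with t ht htpos x
  exact (ENNReal.ofReal_le_ofReal ht.le).trans (hC t htpos x)

/-! ### Smooth configurations, values at the origin, and the saddle -/

/-- The element of `W^{1,2}` given by a smooth function. -/
def W12.ofSmooth (R : ℝ) (ψ : Plane → ℝ) (hψ : ContDiff ℝ ∞ ψ) : W12 R :=
  ⟨(ofCont R ψ hψ.continuous, fun i => ofCont R (partialDeriv i ψ)
    (contDiff_partialDeriv hψ i).continuous),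
    fun i => isWeakPartial_ofCont hψ (contDiff_partialDeriv hψ i).continuous fun _ => rfl⟩

/-- The element of `W^{2,2}` given by a smooth function. -/
def W22.ofSmooth (R : ℝ) (ψ : Plane → ℝ) (hψ : ContDiff ℝ ∞ ψ) : W22 R :=
  ⟨(ofCont R ψ hψ.continuous, fun i => ofCont R (partialDeriv i ψ)
    (contDiff_partialDeriv hψ i).continuous, fun i j => ofCont R (partialDeriv j (partialDeriv i ψ))
    (contDiff_partialDeriv (contDiff_partialDeriv hψ i) j).continuous),
    fun i => isWeakPartial_ofCont hψ (contDiff_partialDeriv hψ i).continuous fun _ => rfl,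
    fun i j => isWeakPartial_ofCont (contDiff_partialDeriv hψ i)
      (contDiff_partialDeriv (contDiff_partialDeriv hψ i) j).continuous fun _ => rfl⟩

lemma W12.ofSmooth_d_ae {ψ : Plane → ℝ} (hψ : ContDiff ℝ ∞ ψ) (i : Fin 2) :
    W12.d (W12.ofSmooth R ψ hψ) i =ᵐ[area R] partialDeriv i ψ :=
  ofCont_ae _ (contDiff_partialDeriv hψ i).continuous

lemma W12.ofSmooth_fn_ae {ψ : Plane → ℝ} (hψ : ContDiff ℝ ∞ ψ) :
    W12.fn (W12.ofSmooth R ψ hψ) =ᵐ[area R] ψ :=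
  ofCont_ae _ hψ.continuous

lemma W22.ofSmooth_fn_ae {ψ : Plane → ℝ} (hψ : ContDiff ℝ ∞ ψ) :
    W22.fn (W22.ofSmooth R ψ hψ) =ᵐ[area R] ψ :=
  ofCont_ae _ hψ.continuous

lemma W22.ofSmooth_d_ae {ψ : Plane → ℝ} (hψ : ContDiff ℝ ∞ ψ) (i : Fin 2) :
    W22.d (W22.ofSmooth R ψ hψ) i =ᵐ[area R] partialDeriv i ψ :=
  ofCont_ae _ (contDiff_partialDeriv hψ i).continuous

lemma W22.ofSmooth_dd_ae {ψ : Plane → ℝ} (hψ : ContDiff ℝ ∞ ψ) (i j : Fin 2) :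
    W22.dd (W22.ofSmooth R ψ hψ) i j =ᵐ[area R] partialDeriv j (partialDeriv i ψ) :=
  ofCont_ae _ (contDiff_partialDeriv (contDiff_partialDeriv hψ i) j).continuous

/-- The average of `|h - c|` over small disks, for `h` with a continuous representative. -/
lemma tendsto_average_of_ae_eq (hR : 0 < R) {h : L2 R} {ψ : Plane → ℝ} (hψ : Continuous ψ)
    (hh : h =ᵐ[area R] ψ) (c : ℝ) :
    Tendsto (fun r : ℝ => ⨍ p in Metric.ball (0 : Plane) r, |h p - c|) (𝓝[>] 0)
      (𝓝 |ψ 0 - c|) := by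
  have hφ : Continuous fun p => |ψ p - c| := (hψ.sub continuous_const).abs
  rw [Metric.tendsto_nhds]
  intro ε hε
  obtain ⟨δ, hδ, hball⟩ := Metric.continuousAt_iff.1 (hφ.continuousAt (x := (0 : Plane))) (ε / 2)
    (half_pos hε)
  filter_upwards [Ioo_mem_nhdsGT (lt_min hδ hR)] with r ⟨hr0, hr⟩
  have e : ⨍ p in Metric.ball (0 : Plane) r, |h p - c| =
      ⨍ p in Metric.ball (0 : Plane) r, |ψ p - c| := by
    refine setAverage_congr_fun Metric.isOpen_ball.measurableSet ?_
    have := ae_restrict_iff' disk_measurableSet |>.1 hh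
    filter_upwards [this] with p hp hpr
    rw [hp (Metric.ball_subset_ball (hr.le.trans (min_le_right _ _)) hpr)]
  rw [e]
  -- An average of values in a closed convex set stays in that set.
  have hmem : ⨍ p in Metric.ball (0 : Plane) r, |ψ p - c| ∈
      Metric.closedBall |ψ 0 - c| (ε / 2) := by
    refine (convex_closedBall _ _).set_average_mem Metric.isClosed_closedBall
      (Metric.measure_ball_pos volume _ hr0).ne' measure_ball_lt_top.ne ?_ ?_
    · filter_upwards [ae_restrict_mem Metric.isOpen_ball.measurableSet] with p hp
      exact (hball (hp.trans (hr.trans_le (min_le_left _ _)))).le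
    · exact (hφ.continuousOn.integrableOn_compact (isCompact_closedBall (0 : Plane) r)).mono_set
        Metric.ball_subset_closedBall
  exact lt_of_le_of_lt hmem (half_lt_self hε)

lemma hasValueAtOrigin_of_ae_eq (hR : 0 < R) {h : L2 R} {ψ : Plane → ℝ} (hψ : Continuous ψ)
    (hh : h =ᵐ[area R] ψ) (h0 : ψ 0 = 0) : HasValueAtOrigin h 0 := by
  simpa [HasValueAtOrigin, h0] using tendsto_average_of_ae_eq hR hψ hh 0

/-- The averages of |h − c| tend both to 0 and to |ψ(0) − c|. This turns the normalization of a
limit into equations for its affine part. -/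
lemma HasValueAtOrigin.eq_of_ae_eq (hR : 0 < R) {h : L2 R} {c : ℝ} (H : HasValueAtOrigin h c)
    {ψ : Plane → ℝ} (hψ : Continuous ψ) (hh : h =ᵐ[area R] ψ) : ψ 0 = c := by
  have := tendsto_nhds_unique H (tendsto_average_of_ae_eq hR hψ hh c)
  exact sub_eq_zero.1 (abs_eq_zero.1 this.symm)

/-- A homogeneous function vanishing at the origin: `c · x (y² - x²)` in the coordinates
`x = pᵢ`, `y = pⱼ`. -/
def cubic (i j : Fin 2) (p : Plane) : ℝ := 1 / 6 * (p i * (p j * p j - p i * p i))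

lemma contDiff_cubic (i j : Fin 2) : ContDiff ℝ ∞ (cubic i j) :=
  contDiff_const.mul ((contDiff_coord i).mul
    (((contDiff_coord j).mul (contDiff_coord j)).sub ((contDiff_coord i).mul (contDiff_coord i))))

/-- The quadratic form `a (u² - v²)/2 + b u v`. -/
def quad (a b : ℝ) (p : Plane) : ℝ := a / 2 * (p 0 * p 0 - p 1 * p 1) + b * (p 0 * p 1)

lemma contDiff_quad (a b : ℝ) : ContDiff ℝ ∞ (quad a b) :=
  (contDiff_const.mul (((contDiff_coord 0).mul (contDiff_coord 0)).sub
    ((contDiff_coord 1).mul (contDiff_coord 1)))).add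
    (contDiff_const.mul ((contDiff_coord 0).mul (contDiff_coord 1)))

lemma differentiable_coord (j : Fin 2) : Differentiable ℝ (fun q : Plane => q j) :=
  (contDiff_coord j).differentiable (by simp)

lemma partialDeriv_cubic (i j k : Fin 2) (p : Plane) : partialDeriv k (cubic i j) p =
    1 / 6 * (p i * (2 * p j * (if k = j then 1 else 0) - 2 * p i * (if k = i then 1 else 0)) +
      (if k = i then 1 else 0) * (p j * p j - p i * p i)) := by
  have dc := differentiable_coord
  unfold cubic
  simp (disch := fun_prop) only [partialDeriv_sub, partialDeriv_mul, partialDeriv_coord,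
      partialDeriv_const]
  ring

lemma partialDeriv_zero_quad (a b : ℝ) : partialDeriv 0 (quad a b) = fun p => a * p 0 + b * p 1 := by
  have dc := differentiable_coord
  funext p
  unfold quad
  simp (disch := fun_prop) only [partialDeriv_add, partialDeriv_sub, partialDeriv_mul,
      partialDeriv_coord, partialDeriv_const]
  simp
  ring

lemma partialDeriv_one_quad (a b : ℝ) :
    partialDeriv 1 (quad a b) = fun p => b * p 0 - a * p 1 := by
  have dc := differentiable_coord
  funext p
  unfold quad
  simp (disch := fun_prop) only [partialDeriv_add, partialDeriv_sub, partialDeriv_mul,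
      partialDeriv_coord, partialDeriv_const]
  simp
  ring

lemma partialDeriv_linear (a b : ℝ) (k : Fin 2) (p : Plane) :
    partialDeriv k (fun p => a * p 0 + b * p 1) p =
      a * (if k = 0 then 1 else 0) + b * (if k = 1 then 1 else 0) := by
  have dc := differentiable_coord
  simp (disch := fun_prop) only [partialDeriv_add, partialDeriv_mul,
      partialDeriv_coord, partialDeriv_const]
  ring

/-- The isometric configuration whose out-of-plane displacement is the two-wave saddle. -/
def saddleConfig (R : ℝ) : Config R :=
  (W12.ofSmooth R (cubic 0 1) (contDiff_cubic 0 1), W12.ofSmooth R (cubic 1 0) (contDiff_cubic 1 0),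
    W22.ofSmooth R (quad 1 0) (contDiff_quad 1 0))

lemma saddleConfig_mem (hR : 0 < R) : saddleConfig R ∈ A₀ R := by
  have hq := contDiff_quad 1 0
  refine ⟨hasValueAtOrigin_of_ae_eq hR (contDiff_cubic 0 1).continuous
      (W12.ofSmooth_fn_ae (contDiff_cubic 0 1)) ?_,
    hasValueAtOrigin_of_ae_eq hR (contDiff_cubic 1 0).continuous
      (W12.ofSmooth_fn_ae (contDiff_cubic 1 0)) ?_,
    hasValueAtOrigin_of_ae_eq hR hq.continuous (W22.ofSmooth_fn_ae hq) ?_,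
    hasValueAtOrigin_of_ae_eq hR (contDiff_partialDeriv hq 0).continuous (W22.ofSmooth_d_ae hq 0) ?_,
    hasValueAtOrigin_of_ae_eq hR (contDiff_partialDeriv hq 1).continuous (W22.ofSmooth_d_ae hq 1) ?_⟩
  · simp [cubic]
  · simp [cubic]
  · simp [quad]
  · simp [partialDeriv_zero_quad]
  · simp [partialDeriv_one_quad]

lemma saddleConfig_fn : W22.fn (Config.ω (saddleConfig R)) =ᵐ[area R] saddle := by
  filter_upwards [W22.ofSmooth_fn_ae (R := R) (contDiff_quad 1 0)] with p hp
  rw [saddleConfig, Config.ω, hp]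
  simp [quad, saddle]
  ring

lemma saddleConfig_isIsometric : IsIsometric (saddleConfig R) := by
  have hf := W12.ofSmooth_d_ae (R := R) (contDiff_cubic 0 1)
  have hg := W12.ofSmooth_d_ae (R := R) (contDiff_cubic 1 0)
  have hw := W22.ofSmooth_d_ae (R := R) (contDiff_quad 1 0)
  filter_upwards [hf 0, hf 1, hg 0, hg 1, hw 0, hw 1] with p f0 f1 g0 g1 w0 w1
  simp only [strain11, strain12, strain22, saddleConfig, Config.f, Config.g, Config.ω, f0, f1,
    g0, g1, w0, w1, partialDeriv_cubic,
    partialDeriv_zero_quad, partialDeriv_one_quad]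
  refine ⟨?_, ?_, ?_⟩ <;> simp <;> ring

lemma saddleConfig_bending (hR : 0 < R) :
    bending (Config.ω (saddleConfig R)) = ENNReal.ofReal (2 * Real.pi * R ^ 2) := by
  have hw := W22.ofSmooth_dd_ae (R := R) (contDiff_quad 1 0)
  have h : ∀ᵐ p ∂(area R), W22.hessianNormSq (Config.ω (saddleConfig R)) p = 2 := by
    filter_upwards [hw 0 0, hw 0 1, hw 1 0, hw 1 1] with p h00 h01 h10 h11
    have e1 : partialDeriv 1 (quad 1 0) = fun p => 0 * p 0 + (-1) * p 1 := by
      rw [partialDeriv_one_quad]; funext p; ring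
    rw [W22.hessianNormSq_eq, saddleConfig, Config.ω, h00, h01, h10, h11, e1, partialDeriv_zero_quad]
    simp only [partialDeriv_linear]
    norm_num
  have h2 : bending (Config.ω (saddleConfig R)) = ∫⁻ _, ENNReal.ofReal 2 ∂(area R) := by
    refine lintegral_congr_ae ?_
    filter_upwards [h] with p hp
    rw [hp]
  rw [h2, lintegral_const, area_univ hR, ← ENNReal.ofReal_mul (by norm_num), mul_assoc]

/-! ### The minimum of `F₀` and the limit of the infima -/

lemma saddleConfig_F₀ (hR : 0 < R) :
    F₀ (saddleConfig R) = ENNReal.ofReal (2 * Real.pi * R ^ 2) := by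
  rw [F₀, if_pos saddleConfig_isIsometric, saddleConfig_bending hR]

lemma le_F₀ (hR : 0 < R) (y : Config R) : ENNReal.ofReal (2 * Real.pi * R ^ 2) ≤ F₀ y := by
  by_cases hy : IsIsometric y
  · rw [F₀, if_pos hy]
    exact (hy.solvesMongeAmpere hR).le_bending hR
  · rw [F₀, if_neg hy]
    exact le_top

lemma ofReal_sq_mul_F {t : ℝ} (ht : 0 < t) (x : Config R) :
    ENNReal.ofReal (t ^ 2) * F t x = elastic t x :=
  ENNReal.mul_div_cancel (by simpa using ht.ne') ENNReal.ofReal_ne_top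

lemma saddleConfig_F (hR : 0 < R) {t : ℝ} (ht : 0 < t) :
    F t (saddleConfig R) = ENNReal.ofReal (2 * Real.pi * R ^ 2) := by
  have hS : stretching (saddleConfig R) = 0 := by
    rw [stretching, ← lintegral_zero (μ := area R)]
    refine lintegral_congr_ae ?_
    filter_upwards [saddleConfig_isIsometric (R := R)] with p ⟨a, b, c⟩
    simp [a, b, c]
  rw [F, elastic, hS, zero_add, saddleConfig_bending hR, mul_comm]
  exact ENNReal.mul_div_cancel_right (by simpa using ht.ne') ENNReal.ofReal_ne_top

/-- The lower bound is uniform over configurations, and the saddle is a normalized competitor whose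
rescaled energy does not depend on t. -/
lemma tendsto_iInf_F (hR : 0 < R) : Tendsto (fun t : ℝ => ⨅ y ∈ A₀ R, F t y) (𝓝[>] 0)
    (𝓝 (ENNReal.ofReal (2 * Real.pi * R ^ 2))) := by
  refine tendsto_order.2 ⟨fun a ha => ?_, fun a ha => ?_⟩
  · obtain ⟨b, hab, hb⟩ := exists_between ha
    have hbt : b ≠ ⊤ := (hb.trans_le le_top).ne
    have hb' : b.toReal < 2 * Real.pi * R ^ 2 := by
      rwa [← ENNReal.ofReal_toReal hbt, ENNReal.ofReal_lt_ofReal_iff (by positivity)] at hb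
    filter_upwards [eventually_le_F hR hb'] with t ht
    rw [ENNReal.ofReal_toReal hbt] at ht
    exact hab.trans_le (le_iInf₂ fun y _ => ht y)
  · filter_upwards [self_mem_nhdsWithin] with t ht
    exact (iInf₂_le _ (saddleConfig_mem hR)).trans_lt (by rwa [saddleConfig_F hR ht])

/-! ### Rellich's theorem on smaller disks -/

lemma inner_ofCont (h : L2 R) {ψ : Plane → ℝ} (hψ : Continuous ψ) :
    inner ℝ (ofCont R ψ hψ) h = ∫ p, h p * ψ p ∂(area R) := by
  rw [L2.inner_def]
  refine integral_congr_ae ?_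
  filter_upwards [ofCont_ae (R := R) ψ hψ] with p hp
  simp [hp]

lemma norm_integral_mul_le (h : L2 R) {ψ : Plane → ℝ} (hψ : Continuous ψ) {K : ℝ} (hK : 0 ≤ K)
    (hb : ∀ p, ‖ψ p‖ ≤ K) : ‖∫ p, h p * ψ p ∂(area R)‖ ≤
      ((measureUnivNNReal (area R) : ℝ) ^ (ENNReal.toReal 2)⁻¹ * K) * ‖h‖ := by
  rw [← inner_ofCont h hψ]
  refine (norm_inner_le_norm _ _).trans (mul_le_mul_of_nonneg_right ?_ (norm_nonneg _))
  refine Lp.norm_le_of_ae_bound hK ?_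
  filter_upwards [ofCont_ae (R := R) ψ hψ] with p hp
  rw [hp]
  exact hb p

/-- Mollifications of a bounded weakly null sequence tend to zero strongly. -/
lemma tendsto_eLpNorm_moll_of_weakly_null {d : ℕ → L2 R} {C : ℝ} (hC : ∀ n, ‖d n‖ ≤ C)
    (hd : ∀ u : L2 R, Tendsto (fun n => inner ℝ u (d n)) atTop (𝓝 0)) (m : ℕ) (r : ℝ) :
    Tendsto (fun n => eLpNorm (moll m (ext (d n))) 2 (area r)) atTop (𝓝 0) := by
  obtain ⟨K, hK⟩ := (ker_compact m).exists_bound_of_continuous (ker_smooth m).continuous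
  have hK0 : 0 ≤ K := (norm_nonneg _).trans (hK 0)
  have hc : ∀ x, Continuous fun t => ker m (x - t) := fun x =>
    (ker_smooth m).continuous.comp (continuous_const.sub continuous_id)
  -- For fixed m and x the mollified value is the inner product with a fixed element of `L²`, so
  -- weak convergence gives pointwise convergence; the uniform bound B below then allows dominated
  -- convergence.
  have hpt : ∀ x, Tendsto (fun n => moll m (ext (d n)) x) atTop (𝓝 0) := fun x => by
    refine (hd (ofCont R _ (hc x))).congr fun n => ?_
    rw [inner_ofCont, moll_apply, integral_ext_mul]
  let B : ℝ := ((measureUnivNNReal (area R) : ℝ) ^ (ENNReal.toReal 2)⁻¹ * K) * C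
  have hB : ∀ n x, ‖moll m (ext (d n)) x‖ ≤ B := fun n x => by
    rw [moll_apply, integral_ext_mul]
    exact (norm_integral_mul_le (d n) (hc x) hK0 fun p => hK _).trans
      (mul_le_mul_of_nonneg_left (hC n) (by positivity))
  have hsq : Tendsto (fun n => ∫⁻ x, ‖moll m (ext (d n)) x‖ₑ ^ 2 ∂(area r)) atTop
      (𝓝 (∫⁻ _, 0 ∂(area r))) := by
    refine tendsto_lintegral_of_dominated_convergence (fun _ => ENNReal.ofReal B ^ 2) (fun n => ?_)
      (fun n => Eventually.of_forall fun x => ?_) ?_ (Eventually.of_forall fun x => ?_)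
    · exact ((contDiff_moll m (ext_locallyIntegrable _)).continuous.measurable.enorm.pow_const 2)
    · refine pow_le_pow_left' ?_ 2
      rw [← ofReal_norm]
      exact ENNReal.ofReal_le_ofReal (hB n x)
    · rw [lintegral_const]
      exact ENNReal.mul_ne_top (by simp) (measure_ne_top _ _)
    · have h1 := ENNReal.Tendsto.pow (n := 2) ((hpt x).enorm)
      simpa using h1
  rw [lintegral_zero] at hsq
  rw [ENNReal.tendsto_nhds_zero]
  intro δ hδ
  have hδ2 : 0 < δ ^ 2 := ENNReal.pow_pos hδ 2
  filter_upwards [ENNReal.tendsto_nhds_zero.1 hsq _ hδ2] with n hn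
  rw [← eLpNorm_two_sq] at hn
  exact (ENNReal.pow_le_pow_left_iff (by norm_num)).1 hn

/-- Rellich's theorem on smaller disks, for weakly null sequences. -/
lemma tendsto_eLpNorm_ext_of_weakly_null {d : ℕ → L2 R} {k : ℕ → Fin 2 → L2 R}
    (H : ∀ n i, IsWeakPartial i (d n) (k n i)) {C : ℝ} (hC : ∀ n, ‖d n‖ ≤ C)
    (hCk : ∀ n i, ‖k n i‖ ≤ C)
    (hd : ∀ u : L2 R, Tendsto (fun n => inner ℝ u (d n)) atTop (𝓝 0)) {r : ℝ} (hr : r < R) :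
    Tendsto (fun n => eLpNorm (ext (d n)) 2 (area r)) atTop (𝓝 0) := by
  rw [ENNReal.tendsto_nhds_zero]
  intro δ hδ
  have hδ2 : 0 < δ / 2 := ENNReal.half_pos hδ.ne'
  have hm : Tendsto (fun m : ℕ => ENNReal.ofReal (1 / ((m : ℝ) + 1)) *
      (ENNReal.ofReal C + ENNReal.ofReal C)) atTop (𝓝 0) := by
    have h1 := ENNReal.tendsto_ofReal tendsto_inv_add_one
    have h2 := ENNReal.Tendsto.mul_const (b := ENNReal.ofReal C + ENNReal.ofReal C) h1
      (Or.inr (by simp))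
    simpa using h2
  -- The mollification scale m is fixed first: its error is at most δ/2 for all n at once, by the
  -- uniform bound on the weak derivatives. Only then is n taken large.
  obtain ⟨m, hm1, hm2⟩ := ((ENNReal.tendsto_nhds_zero.1 hm _ hδ2).and
    (eventually_inv_lt (sub_pos.2 hr))).exists
  filter_upwards [ENNReal.tendsto_nhds_zero.1
    (tendsto_eLpNorm_moll_of_weakly_null hC hd m r) _ hδ2] with n hn
  have e : ext (d n) = moll m (ext (d n)) - (moll m (ext (d n)) - ext (d n)) := by simp
  have a1 : AEStronglyMeasurable (moll m (ext (d n))) :=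
    (memLp_moll m (ext_measurable (d n)) (ext_memLp (d n))).1
  rw [e, ← ENNReal.add_halves δ]
  refine (eLpNorm_sub_le a1.restrict (a1.sub (ext_memLp (d n)).1).restrict (by norm_num)).trans
    (add_le_add hn ?_)
  refine (eLpNorm_moll_sub_le_of_isWeakPartial (H n) (by linarith)).trans (le_trans ?_ hm1)
  gcongr <;>
  · rw [← ofReal_norm]
    exact ENNReal.ofReal_le_ofReal (hCk n _)

/-- Rellich's theorem: local strong convergence of bounded weakly convergent sequences. -/
lemma tendsto_eLpNorm_ext_sub {h : ℕ → L2 R} {k : ℕ → Fin 2 → L2 R} {h₀ : L2 R} {k₀ : Fin 2 → L2 R}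
    (H : ∀ n i, IsWeakPartial i (h n) (k n i)) (H₀ : ∀ i, IsWeakPartial i h₀ (k₀ i)) {C : ℝ}
    (hC : ∀ n, ‖h n‖ ≤ C) (hCk : ∀ n i, ‖k n i‖ ≤ C)
    (hh : ∀ u : L2 R, Tendsto (fun n => inner ℝ u (h n)) atTop (𝓝 (inner ℝ u h₀))) {r : ℝ}
    (hr : r < R) :
    Tendsto (fun n => eLpNorm (ext (h n) - ext h₀) 2 (area r)) atTop (𝓝 0) := by
  have h1 := tendsto_eLpNorm_ext_of_weakly_null (d := fun n => h n - h₀)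
    (k := fun n i => k n i - k₀ i) (C := C + ‖h₀‖ + (‖k₀ 0‖ + ‖k₀ 1‖))
    (fun n i => isWeakPartial_sub (H n i) (H₀ i))
    (fun n => (norm_sub_le _ _).trans (by
      have := norm_nonneg (k₀ 0); have := norm_nonneg (k₀ 1); linarith [hC n]))
    (fun n i => (norm_sub_le _ _).trans (by
      have := norm_nonneg (k₀ 0); have := norm_nonneg (k₀ 1); have := norm_nonneg h₀
      have h1 := hCk n i
      have h2 : ‖k₀ i‖ ≤ ‖k₀ 0‖ + ‖k₀ 1‖ := by fin_cases i <;> simp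
      linarith))
    (fun u => by
      simp only [inner_sub_right]
      simpa using (hh u).sub_const (inner ℝ u h₀)) hr
  refine h1.congr fun n => eLpNorm_congr_ae ?_
  have hsub : area r ≤ area R := Measure.restrict_mono (disk_mono hr.le) le_rfl
  filter_upwards [(Measure.absolutelyContinuous_of_le hsub).ae_le (Lp.coeFn_sub (h n) h₀),
    ae_restrict_mem disk_measurableSet] with p hp hm
  have hm' := disk_mono hr.le hm
  rw [Pi.sub_apply, ext_apply _ hm', ext_apply _ hm', ext_apply _ hm', hp, Pi.sub_apply]

/-- Strong convergence is available only away from the boundary, which suffices because the support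
of η lies in a smaller disk. -/
lemma tendsto_integral_mul_mul_of_weak (hR : 0 < R) {h h' : ℕ → L2 R} {h₀ h₀' : L2 R}
    (hh : ∀ r < R, Tendsto (fun n => eLpNorm (ext (h n) - ext h₀) 2 (area r)) atTop (𝓝 0))
    (hh' : ∀ r < R, Tendsto (fun n => eLpNorm (ext (h' n) - ext h₀') 2 (area r)) atTop (𝓝 0))
    {η : Plane → ℝ} (hη : IsTest R η) :
    Tendsto (fun n => ∫ p, h n p * h' n p * η p ∂(area R)) atTop
      (𝓝 (∫ p, h₀ p * h₀' p * η p ∂(area R))) := by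
  obtain ⟨r, -, hrR, hr⟩ := hη.exists_radius hR
  obtain ⟨C, hC⟩ := hη.bounded
  have e : ∀ a b : L2 R, ∫ p, a p * b p * η p ∂(area R) =
      ∫ p, ext a p * ext b p * η p ∂(area r) := fun a b => by
    rw [← integral_ext_mul_ext_mul, integral_area_eq_of_support fun p hp => by
      rw [image_eq_zero_of_notMem_tsupport fun hm => hp (hr hm), mul_zero]]
  simp only [e]
  exact tendsto_integral_mul_mul (fun n => (ext_memLp _).restrict _) (fun n => (ext_memLp _).restrict _)
    ((ext_memLp _).restrict _) ((ext_memLp _).restrict _) (hh r hrR) (hh' r hrR)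
    hη.smooth.continuous.aestronglyMeasurable hC

/-! ### Weak convergence of configurations -/

/-- The weak derivative as a bounded operator on `W^{1,2}`. -/
def W12.dL (R : ℝ) (i : Fin 2) : W12 R →L[ℝ] L2 R :=
  (ContinuousLinearMap.proj i ∘L ContinuousLinearMap.snd ℝ _ _) ∘L (W12 R).subtypeL

/-- The weak derivative as a bounded operator on `W^{2,2}`. -/
def W22.dL (R : ℝ) (i : Fin 2) : W22 R →L[ℝ] L2 R :=
  (ContinuousLinearMap.proj i ∘L ContinuousLinearMap.fst ℝ _ _ ∘L
    ContinuousLinearMap.snd ℝ _ _) ∘L (W22 R).subtypeL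

/-- The weak second derivative as a bounded operator on `W^{2,2}`. -/
def W22.ddL (R : ℝ) (i j : Fin 2) : W22 R →L[ℝ] L2 R :=
  (ContinuousLinearMap.proj j ∘L ContinuousLinearMap.proj (R := ℝ) (φ := fun _ : Fin 2 => Fin 2 → L2 R) i
    ∘L ContinuousLinearMap.snd ℝ _ _ ∘L
    ContinuousLinearMap.snd ℝ _ _) ∘L (W22 R).subtypeL

/-- The out-of-plane displacement as a bounded operator. -/
def Config.ωL (R : ℝ) : Config R →L[ℝ] W22 R :=
  ContinuousLinearMap.snd ℝ _ _ ∘L ContinuousLinearMap.snd ℝ _ _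

/-- The first in-plane displacement as a bounded operator. -/
def Config.fL (R : ℝ) : Config R →L[ℝ] W12 R := ContinuousLinearMap.fst ℝ _ _

/-- The second in-plane displacement as a bounded operator. -/
def Config.gL (R : ℝ) : Config R →L[ℝ] W12 R :=
  ContinuousLinearMap.fst ℝ _ _ ∘L ContinuousLinearMap.snd ℝ _ _

lemma WeaklyConverges.tendsto_inner {y : ℕ → Config R} {z : Config R} (H : WeaklyConverges y z)
    (T : Config R →L[ℝ] L2 R) (u : L2 R) :
    Tendsto (fun k => inner ℝ u (T (y k))) atTop (𝓝 (inner ℝ u (T z))) :=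
  H ((innerSL ℝ u) ∘L T)

/-- Uniform boundedness principle in the bidual: every functional is bounded along the sequence, and
the canonical embedding is isometric. -/
lemma WeaklyConverges.bounded {y : ℕ → Config R} {z : Config R} (H : WeaklyConverges y z) :
    ∃ C, ∀ k, ‖y k‖ ≤ C := by
  obtain ⟨C, hC⟩ := banach_steinhaus
    (g := fun k => NormedSpace.inclusionInDoubleDual ℝ (Config R) (y k)) (fun l => by
      obtain ⟨C, hC⟩ := (H l).norm.bddAbove_range
      exact ⟨C, fun k => hC ⟨k, rfl⟩⟩)
  refine ⟨C, fun k => ?_⟩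
  have := hC k
  rwa [show ‖NormedSpace.inclusionInDoubleDual ℝ (Config R) (y k)‖ = ‖y k‖ from
    (NormedSpace.inclusionInDoubleDualLi ℝ (E := Config R)).norm_map (y k)] at this

/-- The bound on the second derivatives of ω supplies the compactness for the first derivatives,
whose products enter the strains. -/
lemma WeaklyConverges.tendsto_ext_d {y : ℕ → Config R} {z : Config R} (H : WeaklyConverges y z)
    (i : Fin 2) {r : ℝ} (hr : r < R) :
    Tendsto (fun n => eLpNorm (ext (W22.d (Config.ω (y n)) i) - ext (W22.d (Config.ω z) i)) 2
      (area r)) atTop (𝓝 0) := by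
  obtain ⟨C, hC⟩ := H.bounded
  have hb : ∀ T : Config R →L[ℝ] L2 R, ∀ n, ‖T (y n)‖ ≤ ‖T‖ * C := fun T n =>
    (T.le_opNorm _).trans (mul_le_mul_of_nonneg_left (hC n) (norm_nonneg _))
  let D : Config R →L[ℝ] L2 R := W22.dL R i ∘L Config.ωL R
  let DD : Fin 2 → Config R →L[ℝ] L2 R := fun j => W22.ddL R i j ∘L Config.ωL R
  have hC0 : 0 ≤ C := (norm_nonneg _).trans (hC 0)
  refine tendsto_eLpNorm_ext_sub (k := fun n j => W22.dd (Config.ω (y n)) i j)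
    (k₀ := fun j => W22.dd (Config.ω z) i j) (C := ‖D‖ * C + (‖DD 0‖ * C + ‖DD 1‖ * C))
    (fun n j => W22.isWeakPartial_d _ i j) (fun j => W22.isWeakPartial_d _ i j)
    (fun n => (hb D n).trans (le_add_of_nonneg_right (by positivity))) (fun n j => ?_)
    (fun u => H.tendsto_inner D u) hr
  refine (hb (DD j) n).trans ?_
  have := mul_nonneg (norm_nonneg D) hC0
  have := mul_nonneg (norm_nonneg (DD 0)) hC0
  have := mul_nonneg (norm_nonneg (DD 1)) hC0
  fin_cases j <;> simp <;> linarith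

/-- Weak convergence with vanishing stretching energy: the limit is an isometry. -/
lemma WeaklyConverges.isIsometric (hR : 0 < R) {y : ℕ → Config R} {z : Config R}
    (H : WeaklyConverges y z) (hfin : ∀ k, stretching (y k) ≠ ⊤)
    (hS : Tendsto (fun k => stretching (y k)) atTop (𝓝 0)) : IsIsometric z := by
  have lin : ∀ (T : Config R →L[ℝ] L2 R) {η : Plane → ℝ}, IsTest R η →
      Tendsto (fun k => ∫ p, T (y k) p * η p ∂(area R)) atTop
        (𝓝 (∫ p, T z p * η p ∂(area R))) := fun T η hη => by
    have := H.tendsto_inner T (ofCont R η hη.smooth.continuous)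
    simpa only [inner_ofCont] using this
  have quadr : ∀ (i j : Fin 2) {η : Plane → ℝ}, IsTest R η →
      Tendsto (fun k => ∫ p, W22.d (Config.ω (y k)) i p * W22.d (Config.ω (y k)) j p * η p ∂(area R))
        atTop (𝓝 (∫ p, W22.d (Config.ω z) i p * W22.d (Config.ω z) j p * η p ∂(area R))) :=
    fun i j η hη => tendsto_integral_mul_mul_of_weak hR (fun r hr => H.tendsto_ext_d i hr)
      (fun r hr => H.tendsto_ext_d j hr) hη
  -- The squared `L²` norm of each strain component is at most the stretching energy, hence tends to
  -- 0.
  have small : ∀ (γ : Config R → Plane → ℝ), (∀ x, Measurable (γ x)) →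
      (∀ x p, γ x p ^ 2 ≤ (strain11 x p) ^ 2 + 2 * (strain12 x p) ^ 2 + (strain22 x p) ^ 2) →
      ∀ {η : Plane → ℝ}, IsTest R η →
      Tendsto (fun k => ∫ p, γ (y k) p * η p ∂(area R)) atTop (𝓝 0) := by
    intro γ hm hle η hη
    have hb : ∀ x, eLpNorm (γ x) 2 (area R) ^ 2 ≤ stretching x := fun x => by
      rw [eLpNorm_two_sq]
      refine lintegral_mono fun p => ?_
      rw [enorm_sq]
      exact ENNReal.ofReal_le_ofReal (hle x p)
    have hmem : ∀ k, MemLp (γ (y k)) 2 (area R) := fun k =>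
      ⟨(hm _).aestronglyMeasurable, by
        have := (hb (y k)).trans_lt (lt_top_iff_ne_top.2 (hfin k))
        exact lt_top_iff_ne_top.2 fun h => by simp [h] at this⟩
    have ht : Tendsto (fun k => eLpNorm (γ (y k) - 0) 2 (area R)) atTop (𝓝 0) := by
      rw [ENNReal.tendsto_nhds_zero]
      intro δ hδ
      filter_upwards [ENNReal.tendsto_nhds_zero.1 hS _ (ENNReal.pow_pos hδ 2)] with k hk
      rw [sub_zero]
      exact (ENNReal.pow_le_pow_left_iff (by norm_num)).1 ((hb _).trans hk)
    obtain ⟨C, hC⟩ := hη.bounded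
    have := tendsto_integral_mul_mul (G := fun _ _ => (1 : ℝ)) (G₀ := fun _ => 1) hmem
      (fun _ => memLp_const 1) MemLp.zero (memLp_const 1) ht (by simp)
      hη.smooth.continuous.aestronglyMeasurable hC
    simpa using this
  have iη : ∀ {η χ : Plane → ℝ}, IsTest R η → ContDiff ℝ ∞ χ →
      Integrable (fun p => χ p * η p) (area R) := fun hη hχ => (hη.integrable_mul hχ).restrict
  have c := contDiff_coord
  have T0 : ∀ {γ : Plane → ℝ}, Integrable γ (area R) →
      (∀ η, IsTest R η → ∫ p, γ p * η p ∂(area R) = 0) → ∀ᵐ p ∂(area R), γ p = 0 :=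
    fun h1 h2 => ae_eq_zero_of_forall_test h1 h2
  obtain ⟨s1, s2, s3⟩ := strain_integrable z
  have expand : ∀ (a b : L2 R) (u v : L2 R) {χ η : Plane → ℝ}, ContDiff ℝ ∞ χ → IsTest R η →
      ∫ p, (a p + b p + u p * v p + χ p) * η p ∂(area R) =
        ((∫ p, a p * η p ∂(area R)) + (∫ p, b p * η p ∂(area R))) +
          (∫ p, u p * v p * η p ∂(area R)) + ∫ p, χ p * η p ∂(area R) := by
    intro a b u v χ η hχ hη
    have i1 := integrable_mul_test a hη
    have i2 := integrable_mul_test b hη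
    have i3 := integrable_mul_mul u v hη
    have i4 := iη hη hχ
    have i12 : Integrable (fun p => a p * η p + b p * η p) (area R) := i1.add i2
    have i123 : Integrable (fun p => a p * η p + b p * η p + u p * v p * η p) (area R) := i12.add i3
    simp only [add_mul]
    rw [integral_add i123 i4, integral_add i12 i3, integral_add i1 i2]
  -- Each strain is a sum of two bounded linear terms, a product of first derivatives of ω and a
  -- fixed polynomial. Tested against η, the linear terms converge weakly and the product by
  -- Rellich, so the limit strain has the same pairing 0.
  have conclude : ∀ (γ : Config R → Plane → ℝ) (T T' : Config R →L[ℝ] L2 R) (i j : Fin 2)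
      (χ : Plane → ℝ), ContDiff ℝ ∞ χ → (∀ x p, γ x p = T x p + T' x p +
        W22.d (Config.ω x) i p * W22.d (Config.ω x) j p + χ p) → (∀ x, Measurable (γ x)) →
      (∀ x p, γ x p ^ 2 ≤ (strain11 x p) ^ 2 + 2 * (strain12 x p) ^ 2 + (strain22 x p) ^ 2) →
      Integrable (γ z) (area R) → ∀ᵐ p ∂(area R), γ z p = 0 := by
    intro γ T T' i j χ hχ hγ hm hle hi
    refine T0 hi fun η hη => ?_
    refine tendsto_nhds_unique ?_ (small γ hm hle hη)
    simp only [hγ, expand _ _ _ _ hχ hη]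
    exact (((lin T hη).add (lin T' hη)).add (quadr i j hη)).add_const _
  -- The term 2 f_u is written as f_u + f_u to fit the two-operator form.
  have h1 := conclude strain11 (W12.dL R 0 ∘L Config.fL R) (W12.dL R 0 ∘L Config.fL R) 0 0
    (fun p => -(p 1 ^ 2 / 3)) (((c 1).pow 2).div_const 3).neg (fun x p => by
      simp only [strain11]
      change _ = W12.d (Config.f x) 0 p + W12.d (Config.f x) 0 p + _ + _
      ring) (fun x => (strain_measurable x).1)
      (fun x p => by nlinarith [sq_nonneg (strain12 x p), sq_nonneg (strain22 x p)]) s1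
  have h2 := conclude strain12 (W12.dL R 1 ∘L Config.fL R) (W12.dL R 0 ∘L Config.gL R) 0 1
    (fun p => p 0 * p 1 / 3) (((c 0).mul (c 1)).div_const 3) (fun x p => rfl)
      (fun x => (strain_measurable x).2.1)
      (fun x p => by
        nlinarith [sq_nonneg (strain11 x p), sq_nonneg (strain22 x p), sq_nonneg (strain12 x p)])
      s2
  have h3 := conclude strain22 (W12.dL R 1 ∘L Config.gL R) (W12.dL R 1 ∘L Config.gL R) 1 1
    (fun p => -(p 0 ^ 2 / 3)) (((c 0).pow 2).div_const 3).neg (fun x p => by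
      simp only [strain22]
      change _ = W12.d (Config.g x) 1 p + W12.d (Config.g x) 1 p + _ + _
      ring) (fun x => (strain_measurable x).2.2)
      (fun x p => by nlinarith [sq_nonneg (strain12 x p), sq_nonneg (strain11 x p)]) s3
  filter_upwards [h1, h2, h3] with p a b c
  exact ⟨a, b, c⟩

/-- Expresses the energy by squared Hilbert norms, the form in which weak lower semicontinuity is
immediate. -/
lemma bending_eq_sum (w : W22 R) :
    bending w = ENNReal.ofReal (∑ i, ∑ j, ‖W22.dd w i j‖ ^ 2) := by
  have e : ∀ i j, ∫ p, W22.dd w i j p ^ 2 ∂(area R) = ‖W22.dd w i j‖ ^ 2 := fun i j => by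
    rw [← real_inner_self_eq_norm_sq, L2.inner_def]
    simp [sq]
  have s : ∀ i j, Integrable (fun p => W22.dd w i j p ^ 2) (area R) :=
    fun i j => (Lp.memLp _).integrable_sq
  have s1 : ∀ i, Integrable (fun p => W22.dd w i 0 p ^ 2 + W22.dd w i 1 p ^ 2) (area R) :=
    fun i => (s i 0).add (s i 1)
  rw [bending_eq]
  simp only [W22.hessianNormSq_eq, Fin.sum_univ_two]
  rw [integral_add (s1 0) (s1 1), integral_add (s 0 0) (s 0 1), integral_add (s 1 0) (s 1 1)]
  simp only [e]

/-- Weak lower semicontinuity of the bending energy. -/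
lemma WeaklyConverges.bending_le {y : ℕ → Config R} {z : Config R} (H : WeaklyConverges y z)
    {b : ℕ → ℝ≥0∞} {b₀ : ℝ≥0∞} (hb : ∀ k, bending (Config.ω (y k)) ≤ b k)
    (hlim : Tendsto b atTop (𝓝 b₀)) : bending (Config.ω z) ≤ b₀ := by
  -- The lower bound 2⟨h, hₖ⟩ − ‖h‖² ≤ ‖hₖ‖² is affine in hₖ, and weak convergence sends it to ‖h‖².
  have h1 : ∀ i j, Tendsto (fun k => 2 * inner ℝ (W22.dd (Config.ω z) i j)
      (W22.dd (Config.ω (y k)) i j) - ‖W22.dd (Config.ω z) i j‖ ^ 2) atTop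
      (𝓝 (‖W22.dd (Config.ω z) i j‖ ^ 2)) := fun i j => by
    have := ((H.tendsto_inner (W22.ddL R i j ∘L Config.ωL R) (W22.dd (Config.ω z) i j)).const_mul
      2).sub_const (‖W22.dd (Config.ω z) i j‖ ^ 2)
    have e : (W22.ddL R i j ∘L Config.ωL R) z = W22.dd (Config.ω z) i j := rfl
    rw [e, real_inner_self_eq_norm_sq] at this
    rwa [two_mul (‖W22.dd (Config.ω z) i j‖ ^ 2), add_sub_cancel_right] at this
  have h2 := ENNReal.tendsto_ofReal (tendsto_finsetSum Finset.univ fun i _ =>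
    tendsto_finsetSum Finset.univ fun j _ => h1 i j)
  rw [bending_eq_sum]
  refine le_of_tendsto_of_tendsto' h2 hlim fun k => le_trans ?_ (hb k)
  rw [bending_eq_sum]
  refine ENNReal.ofReal_le_ofReal (Finset.sum_le_sum fun i _ => Finset.sum_le_sum fun j _ => ?_)
  have := sq_nonneg ‖W22.dd (Config.ω z) i j - W22.dd (Config.ω (y k)) i j‖
  rw [norm_sub_sq_real] at this
  linarith

/-! ### The Bochner identity and constancy of the Hessian -/

lemma hasCompactSupport_partialDeriv {ψ : Plane → ℝ} (h : HasCompactSupport ψ) (i : Fin 2) :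
    HasCompactSupport (partialDeriv i ψ) :=
  HasCompactSupport.of_support_subset_isCompact h
    (subset_closure.trans (tsupport_partialDeriv_subset i ψ))

/-- The Bochner identity for pairs satisfying the Cauchy-Riemann equations. -/
lemma bochner_identity {a b η : Plane → ℝ} {U : Set Plane} (hU : IsOpen U) (ha : ContDiff ℝ ∞ a)
    (hb : ContDiff ℝ ∞ b) (hη : ContDiff ℝ ∞ η) (hc : HasCompactSupport η) (hηU : tsupport η ⊆ U)
    (h1 : Set.EqOn (partialDeriv 1 a) (partialDeriv 0 b) U)
    (h2 : Set.EqOn (partialDeriv 0 a) (fun p => -partialDeriv 1 b p) U) :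
    ∫ p, η p * ((partialDeriv 0 a p ^ 2 + partialDeriv 1 a p ^ 2) +
      (partialDeriv 0 b p ^ 2 + partialDeriv 1 b p ^ 2)) =
    1 / 2 * ∫ p, ((a p * a p * partialDeriv 0 (partialDeriv 0 η) p +
      a p * a p * partialDeriv 1 (partialDeriv 1 η) p) +
      (b p * b p * partialDeriv 0 (partialDeriv 0 η) p +
      b p * b p * partialDeriv 1 (partialDeriv 1 η) p)) := by
  have sa : ∀ i, ContDiff ℝ ∞ (partialDeriv i a) := contDiff_partialDeriv ha
  have sb : ∀ i, ContDiff ℝ ∞ (partialDeriv i b) := contDiff_partialDeriv hb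
  have sη : ∀ i, ContDiff ℝ ∞ (partialDeriv i η) := contDiff_partialDeriv hη
  have dda : ∀ i, Differentiable ℝ (partialDeriv i a) := fun i => (sa i).differentiable (by simp)
  have ddb : ∀ i, Differentiable ℝ (partialDeriv i b) := fun i => (sb i).differentiable (by simp)
  have ddη : ∀ i, Differentiable ℝ (partialDeriv i η) := fun i => (sη i).differentiable (by simp)
  have da : Differentiable ℝ a := ha.differentiable (by simp)
  have db : Differentiable ℝ b := hb.differentiable (by simp)
  have dη : Differentiable ℝ η := hη.differentiable (by simp)
  -- Green's vector field for a² + b² and η: its divergence is (a² + b²) Δη − η Δ(a² + b²), and its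
  -- integral vanishes. Harmonicity of a and b on U reduces Δ(a² + b²) to 2(|∇a|² + |∇b|²).
  let Z : Fin 2 → Plane → ℝ := fun i p => (a p * a p + b p * b p) * partialDeriv i η p
    - 2 * ((a p * partialDeriv i a p + b p * partialDeriv i b p) * η p)
  have hZ : ∀ i, ContDiff ℝ ∞ (Z i) := fun i => (((ha.mul ha).add (hb.mul hb)).mul (sη i)).sub
    (contDiff_const.mul (((ha.mul (sa i)).add (hb.mul (sb i))).mul hη))
  have cZ : ∀ i, HasCompactSupport (Z i) := fun i =>
    ((hasCompactSupport_partialDeriv hc i).mul_left).sub (hc.mul_left.mul_left)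
  have lap : ∀ p ∈ U, partialDeriv 0 (partialDeriv 0 a) p + partialDeriv 1 (partialDeriv 1 a) p = 0 ∧
      partialDeriv 0 (partialDeriv 0 b) p + partialDeriv 1 (partialDeriv 1 b) p = 0 := by
    intro p hp
    have e1 : ∀ i, partialDeriv i (partialDeriv 1 a) p = partialDeriv i (partialDeriv 0 b) p :=
      fun i => partialDeriv_eqOn_of_isOpen hU h1 hp
    have e2 : ∀ i, partialDeriv i (partialDeriv 0 a) p = -partialDeriv i (partialDeriv 1 b) p :=
      fun i => (partialDeriv_eqOn_of_isOpen hU h2 hp).trans partialDeriv_neg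
    constructor
    · rw [e1, e2, partialDeriv_comm hb 1 0]; ring
    · have := e2 1
      rw [← e1, partialDeriv_comm ha 0 1]; linarith
  have key : ∀ p, η p * ((partialDeriv 0 a p ^ 2 + partialDeriv 1 a p ^ 2) +
      (partialDeriv 0 b p ^ 2 + partialDeriv 1 b p ^ 2)) =
      1 / 2 * ((a p * a p * partialDeriv 0 (partialDeriv 0 η) p +
      a p * a p * partialDeriv 1 (partialDeriv 1 η) p) +
      (b p * b p * partialDeriv 0 (partialDeriv 0 η) p +
      b p * b p * partialDeriv 1 (partialDeriv 1 η) p)) -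
      1 / 2 * (partialDeriv 0 (Z 0) p + partialDeriv 1 (Z 1) p) := by
    intro p
    have hl : (partialDeriv 0 (partialDeriv 0 a) p + partialDeriv 1 (partialDeriv 1 a) p) * η p = 0 ∧
        (partialDeriv 0 (partialDeriv 0 b) p + partialDeriv 1 (partialDeriv 1 b) p) * η p = 0 := by
      by_cases hp : p ∈ tsupport η
      · simp [lap p (hηU hp)]
      · simp [image_eq_zero_of_notMem_tsupport hp]
    simp (disch := fun_prop) only [Z, partialDeriv_add, partialDeriv_sub, partialDeriv_mul,
      partialDeriv_const]
    linear_combination (-a p) * hl.1 - b p * hl.2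
  simp only [key]
  have iZ : ∀ i, Integrable (partialDeriv i (Z i)) := fun i =>
    (contDiff_partialDeriv (hZ i) i).continuous.integrable_of_hasCompactSupport
      (hasCompactSupport_partialDeriv (cZ i) i)
  have iZ' : Integrable (fun p => 1 / 2 * (partialDeriv 0 (Z 0) p + partialDeriv 1 (Z 1) p)) :=
    ((iZ 0).add (iZ 1)).const_mul _
  have cc : ∀ i, HasCompactSupport (partialDeriv i (partialDeriv i η)) := fun i =>
    hasCompactSupport_partialDeriv (hasCompactSupport_partialDeriv hc i) i
  have int : ∀ {u : Plane → ℝ} (i : Fin 2), ContDiff ℝ ∞ u →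
      Integrable (fun p => u p * u p * partialDeriv i (partialDeriv i η) p) := fun i hu =>
    ((hu.mul hu).mul (contDiff_partialDeriv (sη i) i)).continuous.integrable_of_hasCompactSupport
      (cc i).mul_left
  have iM : Integrable (fun p => 1 / 2 * ((a p * a p * partialDeriv 0 (partialDeriv 0 η) p +
      a p * a p * partialDeriv 1 (partialDeriv 1 η) p) +
      (b p * b p * partialDeriv 0 (partialDeriv 0 η) p +
      b p * b p * partialDeriv 1 (partialDeriv 1 η) p))) :=
    (((int 0 ha).add (int 1 ha)).add ((int 0 hb).add (int 1 hb))).const_mul _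
  rw [integral_sub iM iZ', integral_const_mul, integral_const_mul, integral_add (iZ 0) (iZ 1),
    integral_partialDeriv_eq_zero (hZ 0) (cZ 0), integral_partialDeriv_eq_zero (hZ 1) (cZ 1)]
  ring

lemma moll_congr {n : ℕ} {F G : Plane → ℝ} (h : F =ᵐ[volume] G) : moll n F = moll n G := by
  funext x
  rw [moll_apply, moll_apply]
  refine integral_congr_ae ?_
  filter_upwards [h] with p hp
  rw [hp]

lemma moll_neg (n : ℕ) (F : Plane → ℝ) : moll n (fun p => -F p) = fun p => -moll n F p := by
  funext x
  rw [moll_apply, moll_apply, ← integral_neg]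
  simp only [neg_mul]

lemma ext_ae_eq_neg {h k : L2 R} (e : ∀ᵐ p ∂(area R), h p = -k p) :
    ext h =ᵐ[volume] fun p => -ext k p := by
  filter_upwards [(ae_restrict_iff' disk_measurableSet).1 e] with p hp
  by_cases hd : p ∈ disk R
  · rw [ext_apply _ hd, ext_apply _ hd, hp hd]
  · simp [ext, hd]

lemma tendsto_integral_moll (h : L2 R) {η : Plane → ℝ} (hη : IsTest R η) :
    Tendsto (fun n => ∫ p, moll n (ext h) p * η p ∂(area R)) atTop
      (𝓝 (∫ p, h p * η p ∂(area R))) := by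
  obtain ⟨C, hC⟩ := hη.bounded
  have ht : Tendsto (fun n => eLpNorm (moll n (ext h) - ext h) 2 (area R)) atTop (𝓝 0) :=
    tendsto_of_tendsto_of_tendsto_of_le_of_le tendsto_const_nhds
      (tendsto_moll (ext_measurable h) (ext_memLp h)) (fun _ => zero_le)
      fun _ => eLpNorm_mono_measure _ Measure.restrict_le_self
  have h1 := tendsto_integral_mul_mul (μ := area R) (G := fun _ _ => (1 : ℝ)) (G₀ := fun _ => 1)
    (fun n => (memLp_moll n (ext_measurable h) (ext_memLp h)).restrict _)
    (fun _ => memLp_const 1) ((ext_memLp h).restrict _) (memLp_const 1) ht (by simp)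
    hη.smooth.continuous.aestronglyMeasurable hC
  simp only [mul_one] at h1
  convert h1 using 2
  refine integral_congr_ae ?_
  filter_upwards [ext_ae h] with p hp
  rw [hp]

lemma integral_add_four {α : Type*} [MeasurableSpace α] {μ : Measure α} {A B C D : α → ℝ}
    (hA : Integrable A μ) (hB : Integrable B μ) (hC : Integrable C μ) (hD : Integrable D μ) :
    ∫ p, ((A p + B p) + (C p + D p)) ∂μ =
      ((∫ p, A p ∂μ) + ∫ p, B p ∂μ) + ((∫ p, C p ∂μ) + ∫ p, D p ∂μ) := by
  have h1 : Integrable (fun p => A p + B p) μ := hA.add hB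
  have h2 : Integrable (fun p => C p + D p) μ := hC.add hD
  rw [integral_add h1 h2, integral_add hA hB, integral_add hC hD]

/-- Cauchy-Riemann pairs of constant modulus have vanishing weak gradients. The pair consists of
second weak derivatives of an element of `W^{2,2}`. -/
lemma isWeakPartial_dd_zero (hR : 0 < R) {w : W22 R}
    (htr : ∀ᵐ p ∂(area R), W22.dd w 1 1 p = -W22.dd w 0 0 p)
    (hone : ∀ᵐ p ∂(area R), W22.dd w 0 0 p ^ 2 + W22.dd w 0 1 p ^ 2 = 1) (i : Fin 2) :
    IsWeakPartial i (W22.dd w 0 0) 0 ∧ IsWeakPartial i (W22.dd w 0 1) 0 := by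
  let a : ℕ → Plane → ℝ := fun n => moll n (ext (W22.dd w 0 0))
  let b : ℕ → Plane → ℝ := fun n => moll n (ext (W22.dd w 0 1))
  let W : ℕ → Plane → ℝ := fun n => moll n (ext (W22.fn w))
  let U : ℕ → Set Plane := fun n => disk (R - 1 / ((n : ℝ) + 1))
  have hU : ∀ n, IsOpen (U n) := fun n => Metric.isOpen_ball
  have sa : ∀ n, ContDiff ℝ ∞ (a n) := fun n => contDiff_moll n (ext_locallyIntegrable _)
  have sb : ∀ n, ContDiff ℝ ∞ (b n) := fun n => contDiff_moll n (ext_locallyIntegrable _)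
  have sW : ∀ n, ContDiff ℝ ∞ (W n) := fun n => contDiff_moll n (ext_locallyIntegrable _)
  have e00 : ∀ n, Set.EqOn (partialDeriv 0 (partialDeriv 0 (W n))) (a n) (U n) := fun n =>
    W22.partialDeriv_partialDeriv_moll w n 0 0
  have e01 : ∀ n, Set.EqOn (partialDeriv 1 (partialDeriv 0 (W n))) (b n) (U n) := fun n =>
    W22.partialDeriv_partialDeriv_moll w n 0 1
  have e11 : ∀ n, Set.EqOn (partialDeriv 1 (partialDeriv 1 (W n))) (fun p => -a n p) (U n) :=
    fun n => by
      have := W22.partialDeriv_partialDeriv_moll w n 1 1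
      rwa [moll_congr (ext_ae_eq_neg htr), moll_neg] at this
  have cr1 : ∀ n, Set.EqOn (partialDeriv 1 (a n)) (partialDeriv 0 (b n)) (U n) := fun n p hp => by
    rw [← partialDeriv_eqOn_of_isOpen (hU n) (e00 n) hp,
      ← partialDeriv_eqOn_of_isOpen (hU n) (e01 n) hp,
      partialDeriv_comm (contDiff_partialDeriv (sW n) 0) 1 0]
  have cr2 : ∀ n, Set.EqOn (partialDeriv 0 (a n)) (fun p => -partialDeriv 1 (b n) p) (U n) :=
    fun n p hp => by
      have h1 := partialDeriv_eqOn_of_isOpen (i := 0) (hU n) (e11 n) hp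
      rw [partialDeriv_neg] at h1
      have h2 := partialDeriv_eqOn_of_isOpen (i := 1) (hU n) (e01 n) hp
      have h3 : partialDeriv 1 (partialDeriv 0 (W n)) = partialDeriv 0 (partialDeriv 1 (W n)) :=
        funext fun q => partialDeriv_comm (sW n) 1 0 q
      rw [h3, partialDeriv_comm (contDiff_partialDeriv (sW n) 1) 1 0, h1] at h2
      simp only
      linarith
  have main : ∀ {ξ : Plane → ℝ}, IsTest R ξ →
      Tendsto (fun n => ∫ p, (ξ p * ξ p) * ((partialDeriv 0 (a n) p ^ 2 + partialDeriv 1 (a n) p ^ 2) +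
      (partialDeriv 0 (b n) p ^ 2 + partialDeriv 1 (b n) p ^ 2))) atTop (𝓝 0) := by
    intro ξ hξ
    -- The weight is a square so that the weighted gradient energy controls the `L²` norm of ξ times
    -- each gradient component.
    have hη : IsTest R (fun p => ξ p * ξ p) := hξ.mul_left hξ.smooth
    set η : Plane → ℝ := fun p => ξ p * ξ p with hηdef
    obtain ⟨r, -, hrR, hr⟩ := hη.exists_radius hR
    have t := fun i => (hη.partialDeriv i).partialDeriv i
    have q := fun (h : L2 R) i => tendsto_integral_moll_mul h h (t i)
    have hlim := (((q (W22.dd w 0 0) 0).add (q (W22.dd w 0 0) 1)).add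
      ((q (W22.dd w 0 1) 0).add (q (W22.dd w 0 1) 1))).const_mul (1 / 2)
    -- Here a² + b² = 1 enters: the limit of the Bochner integrals reduces to ∫ Δη = 0.
    have zero : ((∫ p, W22.dd w 0 0 p * W22.dd w 0 0 p * partialDeriv 0 (partialDeriv 0 η) p ∂(area R))
        + ∫ p, W22.dd w 0 0 p * W22.dd w 0 0 p * partialDeriv 1 (partialDeriv 1 η) p ∂(area R)) +
        ((∫ p, W22.dd w 0 1 p * W22.dd w 0 1 p * partialDeriv 0 (partialDeriv 0 η) p ∂(area R))
        + ∫ p, W22.dd w 0 1 p * W22.dd w 0 1 p * partialDeriv 1 (partialDeriv 1 η) p ∂(area R)) = 0 := by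
      rw [← integral_add_four (integrable_mul_mul _ _ (t 0)) (integrable_mul_mul _ _ (t 1))
        (integrable_mul_mul _ _ (t 0)) (integrable_mul_mul _ _ (t 1))]
      have i2 : ∀ i, ∫ p, partialDeriv i (partialDeriv i η) p ∂(area R) = 0 := fun i => by
        rw [integral_area_eq_of_support fun p hp => (t i).eq_zero_of_notMem hp]
        exact integral_partialDeriv_eq_zero (hη.partialDeriv i).smooth (hη.partialDeriv i).compact i
      have : ∫ p, (partialDeriv 0 (partialDeriv 0 η) p + partialDeriv 1 (partialDeriv 1 η) p)
          ∂(area R) = 0 := by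
        rw [integral_add (integrable_of_continuous (t 0).smooth.continuous)
          (integrable_of_continuous (t 1).smooth.continuous), i2, i2, add_zero]
      rw [← this]
      refine integral_congr_ae ?_
      filter_upwards [hone] with p hp
      linear_combination (partialDeriv 0 (partialDeriv 0 η) p +
        partialDeriv 1 (partialDeriv 1 η) p) * hp
    rw [zero, mul_zero] at hlim
    refine hlim.congr' ?_
    filter_upwards [eventually_inv_lt (sub_pos.2 hrR)] with n hn
    have hsub : disk r ⊆ U n := disk_mono (by linarith)
    rw [bochner_identity (hU n) (sa n) (sb n) hη.smooth hη.compact (hr.trans hsub) (cr1 n) (cr2 n)]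
    have int : ∀ {u : Plane → ℝ} (i : Fin 2), ContDiff ℝ ∞ u →
        Integrable (fun p => u p * u p * partialDeriv i (partialDeriv i η) p) := fun i hu =>
      (t i).integrable_mul (hu.mul hu)
    rw [integral_add_four (int 0 (sa n)) (int 1 (sa n)) (int 0 (sb n)) (int 1 (sb n))]
  have grad : ∀ (h : L2 R), (∀ n (p : Plane), partialDeriv i (moll n (ext h)) p ^ 2 ≤
      (partialDeriv 0 (a n) p ^ 2 + partialDeriv 1 (a n) p ^ 2) +
      (partialDeriv 0 (b n) p ^ 2 + partialDeriv 1 (b n) p ^ 2)) → IsWeakPartial i h 0 := by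
    intro h hle ξ hξ
    have sh : ∀ n, ContDiff ℝ ∞ (moll n (ext h)) := fun n =>
      contDiff_moll n (ext_locallyIntegrable _)
    let G : ℕ → Plane → ℝ := fun n p => partialDeriv i (moll n (ext h)) p * ξ p
    have cG : ∀ n, Continuous (G n) := fun n =>
      (contDiff_partialDeriv (sh n) i).continuous.mul hξ.smooth.continuous
    have hG : Tendsto (fun n => eLpNorm (G n - 0) 2 (area R)) atTop (𝓝 0) := by
      rw [ENNReal.tendsto_nhds_zero]
      intro δ hδ
      have hm := ENNReal.tendsto_ofReal (main hξ)
      rw [ENNReal.ofReal_zero] at hm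
      filter_upwards [ENNReal.tendsto_nhds_zero.1 hm _ (ENNReal.pow_pos hδ 2)] with n hn
      refine (ENNReal.pow_le_pow_left_iff (two_ne_zero)).1 (le_trans ?_ hn)
      have hcs : Continuous fun p => (ξ p * ξ p) * ((partialDeriv 0 (a n) p ^ 2 +
          partialDeriv 1 (a n) p ^ 2) + (partialDeriv 0 (b n) p ^ 2 + partialDeriv 1 (b n) p ^ 2)) := by
        have c0 := fun j => (contDiff_partialDeriv (sa n) j).continuous
        have c1 := fun j => (contDiff_partialDeriv (sb n) j).continuous
        exact (hξ.smooth.continuous.mul hξ.smooth.continuous).mul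
          ((((c0 0).pow 2).add ((c0 1).pow 2)).add (((c1 0).pow 2).add ((c1 1).pow 2)))
      rw [sub_zero, eLpNorm_two_sq, ofReal_integral_eq_lintegral_ofReal
        (hcs.integrable_of_hasCompactSupport (hξ.compact.mul_right.mul_right))
        (Eventually.of_forall fun p => mul_nonneg (mul_self_nonneg _) (by positivity))]
      refine (lintegral_mono fun p => ?_).trans (lintegral_mono' Measure.restrict_le_self le_rfl)
      rw [enorm_sq]
      refine ENNReal.ofReal_le_ofReal ?_
      simp only [G]
      nlinarith [mul_le_mul_of_nonneg_left (hle n p) (mul_self_nonneg (ξ p))]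
    have h1 := tendsto_integral_mul_mul (μ := area R) (G := fun _ _ => (1 : ℝ)) (G₀ := fun _ => 1)
      (ψ := fun _ => 1) (C := 1) (fun n => memLp_of_continuous (cG n)) (fun _ => memLp_const 1)
      MemLp.zero (memLp_const 1) hG (by simp) aestronglyMeasurable_const (by simp)
    simp only [mul_one, Pi.zero_apply, integral_zero] at h1
    have h2 := tendsto_integral_moll h (hξ.partialDeriv i)
    -- Integration by parts for the mollification. Its right side tends to 0, so the weak derivative
    -- of the limit vanishes.
    have h3 : ∀ n, ∫ p, moll n (ext h) p * partialDeriv i ξ p ∂(area R) =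
        -∫ p, G n p ∂(area R) := by
      intro n
      rw [integral_area_eq_of_support fun p hp => by
          rw [(hξ.partialDeriv i).eq_zero_of_notMem hp, mul_zero],
        integral_area_eq_of_support fun p hp => by
          simp only [G]; rw [hξ.eq_zero_of_notMem hp, mul_zero]]
      have hz := integral_partialDeriv_eq_zero (hξ.mul_left (sh n)).smooth
        (hξ.mul_left (sh n)).compact i
      have hpd : ∀ p, partialDeriv i (fun q => moll n (ext h) q * ξ q) p =
          moll n (ext h) p * partialDeriv i ξ p + G n p := fun p =>
        partialDeriv_mul (differentiableAt_of_smooth (sh n) p)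
          (differentiableAt_of_smooth hξ.smooth p)
      simp only [hpd] at hz
      rw [integral_add ((hξ.partialDeriv i).integrable_mul (sh n))
        (hξ.integrable_mul (contDiff_partialDeriv (sh n) i))] at hz
      linarith
    have h4 := h1.neg
    rw [neg_zero] at h4
    have h5 : ∫ p, h p * partialDeriv i ξ p ∂(area R) = 0 :=
      tendsto_nhds_unique h2 (h4.congr fun n => (h3 n).symm)
    have h6 : ∫ p, (0 : L2 R) p * ξ p ∂(area R) = 0 := by
      rw [← integral_zero Plane ℝ (μ := area R)]
      refine integral_congr_ae ?_
      filter_upwards [Lp.coeFn_zero ℝ 2 (area R)] with p hp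
      rw [hp, Pi.zero_apply, zero_mul]
    rw [h5, h6, neg_zero]
  constructor
  · refine grad _ fun n p => ?_
    change partialDeriv i (a n) p ^ 2 ≤ _
    fin_cases i <;> simp only [Fin.zero_eta, Fin.mk_one, Fin.isValue] <;>
      nlinarith [sq_nonneg (partialDeriv 0 (a n) p), sq_nonneg (partialDeriv 1 (a n) p),
        sq_nonneg (partialDeriv 0 (b n) p), sq_nonneg (partialDeriv 1 (b n) p)]
  · refine grad _ fun n p => ?_
    change partialDeriv i (b n) p ^ 2 ≤ _
    fin_cases i <;> simp only [Fin.zero_eta, Fin.mk_one, Fin.isValue] <;>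
      nlinarith [sq_nonneg (partialDeriv 0 (a n) p), sq_nonneg (partialDeriv 1 (a n) p),
        sq_nonneg (partialDeriv 0 (b n) p), sq_nonneg (partialDeriv 1 (b n) p)]

/-! ### Classification of the extremal displacements -/

/-- A function whose weak gradient is that of a smooth function differs from it by a constant. -/
lemma ae_eq_add_const (hR : 0 < R) {h : L2 R} {k : Fin 2 → L2 R} (H : ∀ i, IsWeakPartial i h (k i))
    {ψ : Plane → ℝ} (hψ : ContDiff ℝ ∞ ψ) (hk : ∀ i, k i =ᵐ[area R] partialDeriv i ψ) :
    ∃ c : ℝ, ∀ᵐ p ∂(area R), h p = ψ p + c := by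
  have h1 : ∀ i, IsWeakPartial i (h - ofCont R ψ hψ.continuous) 0 := fun i => by
    have := isWeakPartial_sub (H i) (isWeakPartial_ofCont (R := R) (i := i) hψ
      (contDiff_partialDeriv hψ i).continuous fun _ => rfl)
    have e : k i = ofCont R (partialDeriv i ψ) (contDiff_partialDeriv hψ i).continuous :=
      Lp.ext ((hk i).trans (ofCont_ae _ _).symm)
    rwa [← e, sub_self] at this
  obtain ⟨c, hc⟩ := ae_const_of_isWeakPartial_zero hR h1
  refine ⟨c, ?_⟩
  filter_upwards [hc, Lp.coeFn_sub h (ofCont R ψ hψ.continuous),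
    ofCont_ae (R := R) ψ hψ.continuous] with p h1 h2 h3
  rw [h2, Pi.sub_apply, h3] at h1
  linarith

lemma saddle_rot (α : ℝ) (p : Plane) :
    saddle (rot α p) = quad (Real.cos (2 * α)) (-Real.sin (2 * α)) p := by
  simp only [saddle, rot, quad, Real.cos_two_mul', Real.sin_two_mul]
  simp
  ring

lemma exists_angle {A B : ℝ} (h : A ^ 2 + B ^ 2 = 1) :
    ∃ α : ℝ, Real.cos (2 * α) = A ∧ -Real.sin (2 * α) = B := by
  have hn : ‖(⟨A, B⟩ : ℂ)‖ = 1 := by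
    rw [Complex.norm_def, Complex.normSq_mk, ← sq, ← sq, h, Real.sqrt_one]
  have h0 : (⟨A, B⟩ : ℂ) ≠ 0 := fun h => by simp [h] at hn
  -- A + iB lies on the unit circle. The saddle rotates with the double angle and its uv-coefficient
  -- is −sin 2α, hence half the argument with a minus sign.
  refine ⟨-(Complex.arg ⟨A, B⟩) / 2, ?_, ?_⟩
  · rw [mul_div_cancel₀ _ two_ne_zero, Real.cos_neg, Complex.cos_arg h0, hn, div_one]
  · rw [mul_div_cancel₀ _ two_ne_zero, Real.sin_neg, neg_neg, Complex.sin_arg, hn, div_one]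

/-- Solutions of the Monge-Ampère equation with minimal bending energy have a harmonic
out-of-plane displacement. -/
lemma SolvesMongeAmpere.equality (hR : 0 < R) {w : W22 R} (hw : SolvesMongeAmpere w)
    (hb : bending w ≤ ENNReal.ofReal (2 * Real.pi * R ^ 2)) :
    ∀ᵐ p ∂(area R), W22.dd w 1 1 p = -W22.dd w 0 0 p ∧ W22.dd w 1 0 p = W22.dd w 0 1 p ∧
      W22.dd w 0 0 p ^ 2 + W22.dd w 0 1 p ^ 2 = 1 := by
  have hi := W22.integrable_hessianNormSq w
  have hle : ∫ p, (W22.hessianNormSq w p - 2) ∂(area R) ≤ 0 := by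
    rw [bending_eq, ENNReal.ofReal_le_ofReal_iff (by positivity)] at hb
    rw [integral_sub hi (integrable_const 2), integral_const, Measure.real, area_univ hR,
      ENNReal.toReal_ofReal (by positivity), smul_eq_mul]
    linarith
  have hnn : 0 ≤ᵐ[area R] fun p => W22.hessianNormSq w p - 2 := by
    filter_upwards [hw.two_le] with p hp using sub_nonneg.2 hp
  -- A nonnegative function with nonpositive integral vanishes a.e., so equality holds in the
  -- pointwise bound.
  have hz := (integral_eq_zero_iff_of_nonneg_ae hnn (hi.sub (integrable_const 2))).1
    (le_antisymm hle (integral_nonneg_of_ae hnn))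
  filter_upwards [hz, hw] with p h1 h2
  simp only [Pi.zero_apply] at h1
  have h3 := W22.hessianNormSq_add_det w p
  have h4 := W22.hessian_det w p
  rw [h2] at h3 h4
  have h5 : W22.dd w 0 0 p + W22.dd w 1 1 p = 0 := by
    nlinarith [sq_nonneg (W22.dd w 0 0 p + W22.dd w 1 1 p),
      sq_nonneg (W22.dd w 0 1 p - W22.dd w 1 0 p)]
  have h6 : W22.dd w 0 1 p - W22.dd w 1 0 p = 0 := by
    nlinarith [sq_nonneg (W22.dd w 0 0 p + W22.dd w 1 1 p),
      sq_nonneg (W22.dd w 0 1 p - W22.dd w 1 0 p)]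
  have h7 : W22.dd w 1 1 p = -W22.dd w 0 0 p := by linarith
  have h8 : W22.dd w 1 0 p = W22.dd w 0 1 p := by linarith
  refine ⟨h7, h8, ?_⟩
  rw [h7, h8] at h4
  linarith

/-- Rigidity: the solutions of the Monge-Ampère equation with minimal bending energy are the rotated
saddles, up to affine functions. -/
lemma SolvesMongeAmpere.rigidity (hR : 0 < R) {w : W22 R} (hw : SolvesMongeAmpere w)
    (hb : bending w ≤ ENNReal.ofReal (2 * Real.pi * R ^ 2)) :
    ∃ α a b c : ℝ,
      (∀ᵐ p ∂(area R), W22.fn w p = saddle (rot α p) + (a * p 0 + b * p 1) + c) ∧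
      (∀ᵐ p ∂(area R), W22.d w 0 p = partialDeriv 0 (fun q => saddle (rot α q)) p + a) ∧
      (∀ᵐ p ∂(area R), W22.d w 1 p = partialDeriv 1 (fun q => saddle (rot α q)) p + b) := by
  have heq := hw.equality hR hb
  have hz := isWeakPartial_dd_zero hR (heq.mono fun p h => h.1) (heq.mono fun p h => h.2.2)
  obtain ⟨A, hA⟩ := ae_const_of_isWeakPartial_zero hR fun i => (hz i).1
  obtain ⟨B, hB⟩ := ae_const_of_isWeakPartial_zero hR fun i => (hz i).2
  have hne : NeZero (area R) := ⟨by
    rw [area, Ne, Measure.restrict_eq_zero]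
    exact (Metric.measure_ball_pos volume (0 : Plane) hR).ne'⟩
  -- One generic point transfers a² + b² = 1 to the constants A and B.
  obtain ⟨q, hqA, hqB, -, -, hq⟩ := (hA.and (hB.and heq)).exists
  rw [hqA, hqB] at hq
  obtain ⟨α, hα1, hα2⟩ := exists_angle hq
  have hs : (fun q => saddle (rot α q)) = quad A B := by
    funext p
    rw [saddle_rot, hα1, hα2]
  have p0 : partialDeriv 0 (quad A B) = fun p => A * p 0 + B * p 1 := partialDeriv_zero_quad A B
  have p1 : partialDeriv 1 (quad A B) = fun p => B * p 0 + (-A) * p 1 := by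
    rw [partialDeriv_one_quad]; funext p; ring
  have sq := contDiff_quad A B
  obtain ⟨a, ha⟩ := ae_eq_add_const hR (W22.isWeakPartial_d w 0) (contDiff_partialDeriv sq 0)
    (fun i => by
      filter_upwards [hA, hB] with p h1 h2
      rw [p0, partialDeriv_linear]
      fin_cases i <;> simp [h1, h2])
  obtain ⟨b, hb'⟩ := ae_eq_add_const hR (W22.isWeakPartial_d w 1) (contDiff_partialDeriv sq 1)
    (fun i => by
      filter_upwards [hA, hB, heq] with p h1 h2 h3
      rw [p1, partialDeriv_linear]
      fin_cases i <;> simp [h1, h2, h3.1, h3.2.1])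
  have sl : ContDiff ℝ ∞ fun p : Plane => a * p 0 + b * p 1 :=
    (contDiff_const.mul (contDiff_coord 0)).add (contDiff_const.mul (contDiff_coord 1))
  obtain ⟨c, hc⟩ := ae_eq_add_const hR (W22.isWeakPartial_fn w) (sq.add sl) (fun i => by
    filter_upwards [ha, hb'] with p h1 h2
    have e := partialDeriv_add (i := i) (differentiableAt_of_smooth sq p)
      (differentiableAt_of_smooth sl p)
    refine Eq.trans ?_ e.symm
    rw [partialDeriv_linear]
    fin_cases i <;> simp [h1, h2])
  refine ⟨α, a, b, c, ?_, ?_, ?_⟩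
  · filter_upwards [hc] with p hp
    rw [hp, ← hs]
  · rw [hs]; exact ha
  · rw [hs]; exact hb'

end

end SmallSlopes

/-! ### The main theorem -/

theorem mainTheorem4 (R : ℝ) (hR : 0 < R) :
    -- pointwise bound for solutions of the Monge-Ampere equation; isometries are solutions
    (∀ w : W22 R, SolvesMongeAmpere w →
      (∀ᵐ p ∂(area R), 2 ≤ W22.hessianNormSq w p) ∧ ENNReal.ofReal (2 * Real.pi * R ^ 2) ≤ bending w) ∧
    (∀ y : Config R, IsIsometric y → SolvesMongeAmpere (Config.ω y)) ∧
    -- the minimum of the limit functional, over normalized and over all configurations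
    (∃ s ∈ A₀ R, W22.fn (Config.ω s) =ᵐ[area R] saddle ∧
      F₀ s = ENNReal.ofReal (2 * Real.pi * R ^ 2) ∧
      IsMinOn F₀ (A₀ R) s ∧ IsMinOn F₀ Set.univ s) ∧
    -- convergence of the infima
    Tendsto (fun t : ℝ => ⨅ y ∈ A₀ R, F t y) (𝓝[>] 0)
      (𝓝 (ENNReal.ofReal (2 * Real.pi * R ^ 2))) ∧
    -- convergence of minimum values and of minimizers
    (∀ (t : ℕ → ℝ) (x : ℕ → Config R), (∀ k, 0 < t k) → Tendsto t atTop (𝓝 0) →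
      (∀ k, x k ∈ A₀ R ∧ IsMinOn (F (t k)) (A₀ R) (x k)) →
      Tendsto (fun k => F (t k) (x k)) atTop (𝓝 (ENNReal.ofReal (2 * Real.pi * R ^ 2))) ∧
      ∀ (φ : ℕ → ℕ) (z : Config R), StrictMono φ → WeaklyConverges (x ∘ φ) z →
        F₀ z = ENNReal.ofReal (2 * Real.pi * R ^ 2) ∧
        IsMinOn F₀ Set.univ z ∧
        IsIsometric z ∧ SolvesMongeAmpere (Config.ω z) ∧
        (∀ y : Config R, IsIsometric y → bending (Config.ω z) ≤ bending (Config.ω y)) ∧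
        (∃ α a b c : ℝ, ∀ᵐ p ∂(area R),
          W22.fn (Config.ω z) p = saddle (rot α p) + a * p 0 + b * p 1 + c) ∧
        (z ∈ A₀ R → ∃ α : ℝ, ∀ᵐ p ∂(area R), W22.fn (Config.ω z) p = saddle (rot α p))) := by
  have hmin : ∀ z : Config R, F₀ z = ENNReal.ofReal (2 * Real.pi * R ^ 2) →
      ∀ s, IsMinOn F₀ s z := fun z hz s => isMinOn_iff.2 fun y _ => hz ▸ le_F₀ hR y
  refine ⟨fun w hw => ⟨hw.two_le, hw.le_bending hR⟩, fun y hy => hy.solvesMongeAmpere hR,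
    ⟨saddleConfig R, saddleConfig_mem hR, saddleConfig_fn, saddleConfig_F₀ hR,
      hmin _ (saddleConfig_F₀ hR) _, hmin _ (saddleConfig_F₀ hR) _⟩, tendsto_iInf_F hR, ?_⟩
  intro t x htpos ht hx
  have heq : ∀ k, F (t k) (x k) = ⨅ y ∈ A₀ R, F (t k) y := fun k =>
    le_antisymm (le_iInf₂ fun y hy => (hx k).2 hy) (iInf₂_le _ (hx k).1)
  have htw : Tendsto t atTop (𝓝[>] 0) :=
    tendsto_nhdsWithin_iff.2 ⟨ht, Eventually.of_forall htpos⟩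
  have hlim : Tendsto (fun k => F (t k) (x k)) atTop
      (𝓝 (ENNReal.ofReal (2 * Real.pi * R ^ 2))) := by
    simp only [heq]
    exact (tendsto_iInf_F hR).comp htw
  refine ⟨hlim, fun φ z hφ hz => ?_⟩
  -- The saddle is an admissible competitor for every t; this bounds the stretching by a multiple of
  -- t² and makes it vanish in the limit.
  have hFle : ∀ k, F (t k) (x k) ≤ ENNReal.ofReal (2 * Real.pi * R ^ 2) := fun k => by
    rw [← saddleConfig_F hR (htpos k)]
    exact (hx k).2 (saddleConfig_mem hR)
  have hSle : ∀ k, stretching (x k) ≤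
      ENNReal.ofReal (t k ^ 2) * ENNReal.ofReal (2 * Real.pi * R ^ 2) := fun k => by
    refine le_trans ?_ (mul_le_mul_right (hFle k) _)
    rw [ofReal_sq_mul_F (htpos k), elastic]
    exact le_self_add
  have hBle : ∀ k, bending (Config.ω (x k)) ≤ F (t k) (x k) := fun k => by
    have h0 : ENNReal.ofReal (t k ^ 2) ≠ 0 := by simpa using (htpos k).ne'
    rw [F, ENNReal.le_div_iff_mul_le (Or.inl h0) (Or.inl ENNReal.ofReal_ne_top), elastic, mul_comm]
    exact le_add_self
  have hS : Tendsto (fun k => stretching (x k)) atTop (𝓝 0) := by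
    have h1 := ENNReal.Tendsto.mul_const (b := ENNReal.ofReal (2 * Real.pi * R ^ 2))
      (ENNReal.tendsto_ofReal (ht.pow 2)) (Or.inr ENNReal.ofReal_ne_top)
    simp only [ne_eq, OfNat.ofNat_ne_zero, not_false_eq_true, zero_pow, ENNReal.ofReal_zero,
      zero_mul] at h1
    exact tendsto_of_tendsto_of_tendsto_of_le_of_le tendsto_const_nhds h1 (fun _ => zero_le) hSle
  have hfin : ∀ k, stretching (x k) ≠ ⊤ := fun k =>
    ((hSle k).trans_lt (ENNReal.mul_lt_top ENNReal.ofReal_lt_top ENNReal.ofReal_lt_top)).ne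
  have hiso : IsIsometric z := WeaklyConverges.isIsometric hR hz (fun k => hfin (φ k))
    (hS.comp hφ.tendsto_atTop)
  have hMA := hiso.solvesMongeAmpere hR
  have hbz : bending (Config.ω z) ≤ ENNReal.ofReal (2 * Real.pi * R ^ 2) :=
    WeaklyConverges.bending_le hz (fun k => hBle (φ k)) (hlim.comp hφ.tendsto_atTop)
  have hF₀ : F₀ z = ENNReal.ofReal (2 * Real.pi * R ^ 2) := by
    rw [F₀, if_pos hiso]
    exact le_antisymm hbz (hMA.le_bending hR)
  obtain ⟨α, a, b, c, h, h0, h1⟩ := hMA.rigidity hR hbz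
  refine ⟨hF₀, hmin z hF₀ _, hiso, hMA,
    fun y hy => hbz.trans ((hy.solvesMongeAmpere hR).le_bending hR), ⟨α, a, b, c, ?_⟩,
    fun hzA => ⟨α, ?_⟩⟩
  · filter_upwards [h] with p hp
    rw [hp]; ring
  · obtain ⟨-, -, v, v0, v1⟩ := hzA
    have hs : (fun q => saddle (rot α q)) = quad (Real.cos (2 * α)) (-Real.sin (2 * α)) :=
      funext (saddle_rot α)
    have hq := contDiff_quad (Real.cos (2 * α)) (-Real.sin (2 * α))
    simp only [hs] at h0 h1
    -- The gradient of the quadratic part vanishes at the origin, so the prescribed values of ω_u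
    -- and ω_v there are a and b; then the value of ω is c.
    have ha : a = 0 := by
      simpa [partialDeriv_zero_quad] using v0.eq_of_ae_eq hR
        ((contDiff_partialDeriv hq 0).continuous.add continuous_const) h0
    have hb : b = 0 := by
      simpa [partialDeriv_one_quad] using v1.eq_of_ae_eq hR
        ((contDiff_partialDeriv hq 1).continuous.add continuous_const) h1
    simp only [ha, hb, zero_mul, add_zero, saddle_rot] at h
    have hc : c = 0 := by
      simpa [quad] using v.eq_of_ae_eq hR (hq.continuous.add continuous_const) h
    filter_upwards [h] with p hp
    rw [hp, hc, add_zero, saddle_rot]
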